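/- \textbf{Setting.} For $A\in\mathbb{R}^{m\times n}$ (rows are data points) and $1\le k\le m$, a cluster indicator matrix is a matrix $X\in\mathbb{R}^{m\times k}$ for which there is a partition of $\{1,\dots,m\}$ into $k$ non-empty sets $S_1,\dots,S_k$ with $X_{ij}=1/\sqrt{|S_j|}$ if $i\in S_j$ and $X_{ij}=0$ otherwise. Let $\mathcal F(A,X)=\|A-XX^{T}A\|_F^2$ and $\mathrm F_{\mathrm{opt}}(A)=\min_X\mathcal F(A,X)$, the minimum being over all $m\times k$ cluster indicator matrices. For $\gamma\ge 1$, a randomized algorithm is a $\gamma$-approximation $k$-means algorithm with failure probability $\delta_\gamma$ if, on every data set $D$, it returns a cluster indicator matrix $X_\gamma$ such that $\mathcal F(D,X_\gamma)\le\gamma\,\mathrm F_{\mathrm{opt}}(D)$ with probability at least $1-\delta_\gamma$. For $1\le k\le n$ and $\eta>0$ let $\mathrm{FastFrobeniusSVD}(A,k,\eta)$ be the following randomized algorithm: put $r=k+\lceil k/\eta+1\rceil$; draw $R\in\mathbb{R}^{n\times r}$ with i.i.d. $\mathcal N(0,1)$ entries; compute $Y=AR$; compute by the Gram--Schmidt process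 a matrix $Q$ whose columns form an orthonormal basis of the column space of $Y$; return the matrix $Z\in\mathbb{R}^{n\times k}$ of top $k$ right singular vectors of $Q^{T}A$ (any valid choice of them). The running time is the number of steps in exact real arithmetic, where arithmetic operations, square roots, zero tests and draws of a standard Gaussian are one step each, and the computation of the top $k\le q$ right singular vectors of a $p\times q$ matrix takes $O(pq\min\{p,q\}+qk^2)$ steps. \textbf{Theorem.} Let $A\in\mathbb{R}^{m\times n}$, $1\le k\le\min\{m,n\}$ and $0<\varepsilon<1$. Compute $Z=\mathrm{FastFrobeniusSVD}(A,k,\varepsilon/100)$ and form $C=AZ\in\mathbb{R}^{m\times k}$, which has exactly $k$ features. This always takes $O(mnk/\varepsilon)$ time, where the implied constant is absolute (up to its dependence on the constant of the singular value routine). Run any $\gamma$-approximation $k$-means algorithm ($\gamma\ge1$) with failure probability $\delta_\gamma$, using independent randomness, on $C$ and $k$, and let $X_{\tilde\gamma}$ be its output. Then, with probability at least $0.99-\delta_\gamma$, $$\|A-X_{\tilde\gamma}X_{\tilde\gamma}^{T}A\|_F^2\le\bigl(1+(1+\varepsilon)\gamma\bigr)\,\mathrm F_{\mathrm{opt}}(A).$$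 -/

import Mathlib

open MeasureTheory ProbabilityTheory

/-! ### The k-means problem in matrix form -/

/-- The squared Frobenius norm. -/
def frobSq {p q : ℕ} (M : Matrix (Fin p) (Fin q) ℝ) : ℝ :=
  ∑ i, ∑ j, M i j ^ 2

/-- `X` is the cluster indicator matrix of a partition of the `m` data points into `k` non-empty
clusters: if `σ i` is the cluster of point `i` and `s j` is the size of cluster `j`, then
`X i j = 1 / √(s j)` when `σ i = j`, and `X i j = 0` otherwise. -/
def IsClusterIndicator {m k : ℕ} (X : Matrix (Fin m) (Fin k) ℝ) : Prop :=
  ∃ σ : Fin m → Fin k, Function.Surjective σ ∧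
    ∀ i j, X i j =
      if σ i = j then 1 / Real.sqrt ((Finset.univ.filter fun a => σ a = j).card : ℝ) else 0

/-- The k-means cost `‖A - X Xᵀ A‖_F²` of the clustering `X` on the data set `A` (rows = points). -/
def clusteringCost {m n k : ℕ} (A : Matrix (Fin m) (Fin n) ℝ)
    (X : Matrix (Fin m) (Fin k) ℝ) : ℝ :=
  frobSq (A - X * X.transpose * A)

/-- The optimal k-means cost of `A` with `k` clusters.  It is an attained minimum whenever
`1 ≤ k ≤ m`, see `isLeast_optCost`. -/
noncomputable def optCost {m n : ℕ} (A : Matrix (Fin m) (Fin n) ℝ) (k : ℕ) : ℝ :=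
  sInf {c : ℝ | ∃ X : Matrix (Fin m) (Fin k) ℝ, IsClusterIndicator X ∧ clusteringCost A X = c}

theorem finite_clusterIndicator (m k : ℕ) :
    {X : Matrix (Fin m) (Fin k) ℝ | IsClusterIndicator X}.Finite := by
  refine (Set.finite_range (fun σ : Fin m → Fin k => (Matrix.of fun i j =>
      if σ i = j then 1 / Real.sqrt ((Finset.univ.filter fun a => σ a = j).card : ℝ) else 0 :
      Matrix (Fin m) (Fin k) ℝ))).subset ?_
  rintro X ⟨σ, -, h⟩
  exact ⟨σ, by ext i j; simp [h]⟩

theorem isLeast_optCost {m n k : ℕ} (hk : 1 ≤ k) (hkm : k ≤ m) (A : Matrix (Fin m) (Fin n) ℝ) :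
    IsLeast {c : ℝ | ∃ X : Matrix (Fin m) (Fin k) ℝ, IsClusterIndicator X ∧
      clusteringCost A X = c} (optCost A k) := by
  have hfin : {c : ℝ | ∃ X : Matrix (Fin m) (Fin k) ℝ, IsClusterIndicator X ∧
      clusteringCost A X = c}.Finite := (finite_clusterIndicator m k).image (clusteringCost A)
  refine ⟨Set.Nonempty.csInf_mem ?_ hfin, fun c hc => csInf_le hfin.bddBelow hc⟩
  refine ⟨_, _, ⟨fun i => ⟨min i.1 (k - 1), by omega⟩, fun j => ⟨⟨j.1, by omega⟩, ?_⟩,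
    fun i j => rfl⟩, rfl⟩
  ext
  simp only
  omega

/-- A randomized k-means algorithm, on data sets of `m` points in `ℝ^d` and with `k` clusters,
is described by the law of its output on each data set.  It is a `γ`-approximation with failure
probability `δ` if it always returns a cluster indicator matrix and if, on every data set, the cost
of this matrix is with probability at least `1 - δ` at most `γ` times the optimal cost. -/
def IsApproxKMeans {m d k : ℕ}
    (alg : Matrix (Fin m) (Fin d) ℝ → PMF (Matrix (Fin m) (Fin k) ℝ)) (γ δ : ℝ) : Prop :=
  1 ≤ γ ∧ ∀ D : Matrix (Fin m) (Fin d) ℝ,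
    (∀ X ∈ (alg D).support, IsClusterIndicator X) ∧
    ENNReal.ofReal (1 - δ) ≤
      (alg D).toOuterMeasure {X | clusteringCost D X ≤ γ * optCost D k}

/-! ### Singular vectors -/

/-- The columns of `Z` are top `k` right singular vectors of `B`: they are the first `k` columns of
an orthogonal matrix `V` of right singular vectors (`BᵀB V = V Σ²`) for the singular values
`s 0 ≥ s 1 ≥ ⋯ ≥ 0` of `B`, which are listed in non-increasing order and with zeros included. -/
def IsTopRightSingularVectors {p q k : ℕ} (hk : k ≤ q) (B : Matrix (Fin p) (Fin q) ℝ)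
    (Z : Matrix (Fin q) (Fin k) ℝ) : Prop :=
  ∃ (V : Matrix (Fin q) (Fin q) ℝ) (s : Fin q → ℝ),
    V.transpose * V = 1 ∧ Antitone s ∧ (∀ i, 0 ≤ s i) ∧
    B.transpose * B * V = V * Matrix.diagonal (fun i => s i ^ 2) ∧
    ∀ i j, Z i j = V i (Fin.castLE hk j)

/-- A routine for the exact singular value decomposition.  Singular vectors are not unique; a
routine may return any valid choice. -/
structure SVDRoutine where
  topVectors : ∀ (p q k : ℕ), k ≤ q → Matrix (Fin p) (Fin q) ℝ → Matrix (Fin q) (Fin k) ℝ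
  isTop : ∀ (p q k : ℕ) (hk : k ≤ q) (B : Matrix (Fin p) (Fin q) ℝ),
    IsTopRightSingularVectors hk B (topVectors p q k hk B)

theorem exists_topRightSingularVectors {p q k : ℕ} (hk : k ≤ q) (B : Matrix (Fin p) (Fin q) ℝ) :
    ∃ Z : Matrix (Fin q) (Fin k) ℝ, IsTopRightSingularVectors hk B Z := by
  have hpos : (B.transpose * B).PosSemidef := by
    simpa [Matrix.conjTranspose_eq_transpose_of_trivial] using
      Matrix.posSemidef_conjTranspose_mul_self B
  have hH := hpos.isHermitian
  let e : Fin q ≃ Fin q :=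
    (finCongr (Fintype.card_fin q).symm).trans (Fintype.equivOfCardEq (Fintype.card_fin _))
  let s : Fin q → ℝ := fun i => Real.sqrt (hH.eigenvalues (e i))
  have he : ∀ i, hH.eigenvalues (e i) = hH.eigenvalues₀ (finCongr (Fintype.card_fin q).symm i) := by
    intro i
    simp [Matrix.IsHermitian.eigenvalues, e]
  let V : Matrix (Fin q) (Fin q) ℝ := Matrix.of fun i j => (hH.eigenvectorBasis (e j)).ofLp i
  have hV : ∀ i j, V i j = (hH.eigenvectorBasis (e j)).ofLp i := fun _ _ => rfl
  refine ⟨Matrix.of fun i j => V i (Fin.castLE hk j), V, s, ?_, ?_, fun i => Real.sqrt_nonneg _, ?_,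
    fun i j => rfl⟩
  · ext i j
    have h := (orthonormal_iff_ite.1 hH.eigenvectorBasis.orthonormal) (e i) (e j)
    rw [EuclideanSpace.inner_eq_star_dotProduct] at h
    simp only [dotProduct, star_trivial, e.injective.eq_iff] at h
    rw [Matrix.mul_apply, Matrix.one_apply, ← h]
    refine Finset.sum_congr rfl fun a _ => ?_
    rw [Matrix.transpose_apply, hV, hV, mul_comm]
  · intro i j hij
    refine Real.sqrt_le_sqrt ?_
    rw [he, he]
    exact hH.eigenvalues₀_antitone hij
  · ext i j
    have h := congrFun (hH.mulVec_eigenvectorBasis (e j)) i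
    rw [Matrix.mul_diagonal, Real.sq_sqrt (hpos.eigenvalues_nonneg (e j)), hV]
    simp only [Pi.smul_apply, smul_eq_mul] at h
    rw [mul_comm (_ : ℝ), ← h]
    rfl

theorem nonempty_svdRoutine : Nonempty SVDRoutine :=
  ⟨⟨fun _ _ _ hk B => (exists_topRightSingularVectors hk B).choose,
    fun _ _ _ hk B => (exists_topRightSingularVectors hk B).choose_spec⟩⟩

/-! ### Randomized real-number programs and their running time -/

/-- Randomized programs over real numbers.  The type `V` of real values is kept abstract: programs
are written for every `V`, so that a program can produce, combine and test real values only through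
the instructions below. -/
inductive RealProg (V α : Type) : Type
  | ret (a : α)
  | zero (next : V → RealProg V α)
  | add (x y : V) (next : V → RealProg V α)
  | sub (x y : V) (next : V → RealProg V α)
  | mul (x y : V) (next : V → RealProg V α)
  | div (x y : V) (next : V → RealProg V α)
  | sqrt (x : V) (next : V → RealProg V α)
  | isZero (x : V) (next : Bool → RealProg V α)
  | gauss (next : V → RealProg V α)
  | topSV {p q : ℕ} (k : ℕ) (hk : k ≤ q) (B : Matrix (Fin p) (Fin q) V)
      (next : Matrix (Fin q) (Fin k) V → RealProg V α)

namespace RealProg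

/-- Sequential composition. -/
def bind {V α β : Type} : RealProg V α → (α → RealProg V β) → RealProg V β
  | ret a, f => f a
  | zero g, f => zero fun v => bind (g v) f
  | add x y g, f => add x y fun v => bind (g v) f
  | sub x y g, f => sub x y fun v => bind (g v) f
  | mul x y g, f => mul x y fun v => bind (g v) f
  | div x y g, f => div x y fun v => bind (g v) f
  | sqrt x g, f => sqrt x fun v => bind (g v) f
  | isZero x g, f => isZero x fun b => bind (g b) f
  | gauss g, f => gauss fun v => bind (g v) f
  | topSV k hk B g, f => topSV k hk B fun Z => bind (g Z) f

instance (V : Type) : Monad (RealProg V) where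
  pure := ret
  bind := bind

/-- The result of an execution: the returned value, the number of elementary steps, and the unread
part of the random tape. -/
structure Outcome (α : Type) where
  value : α
  steps : ℕ
  tape : ℕ → ℝ

/-- Count `c` further steps. -/
def Outcome.tick {α : Type} (c : ℕ) (o : Outcome α) : Outcome α :=
  ⟨o.value, o.steps + c, o.tape⟩

open Classical in
/-- Execution of a program in exact real arithmetic.  Every arithmetic operation, square root, zero
test and reading of the next entry of the random tape is one step.  The computation of `k` top right
singular vectors of a `p × q` matrix takes the usual cubic time: `κ (p q min(p,q) + q k²)` steps
(for `k ≤ min(p,q)` the first summand dominates the second one). -/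
noncomputable def exec {α : Type} (svd : SVDRoutine) (κ : ℕ) :
    RealProg ℝ α → (ℕ → ℝ) → Outcome α
  | ret a, ω => ⟨a, 0, ω⟩
  | zero g, ω => (exec svd κ (g 0) ω).tick 1
  | add x y g, ω => (exec svd κ (g (x + y)) ω).tick 1
  | sub x y g, ω => (exec svd κ (g (x - y)) ω).tick 1
  | mul x y g, ω => (exec svd κ (g (x * y)) ω).tick 1
  | div x y g, ω => (exec svd κ (g (x / y)) ω).tick 1
  | sqrt x g, ω => (exec svd κ (g (Real.sqrt x)) ω).tick 1
  | isZero x g, ω => (exec svd κ (g (decide (x = 0))) ω).tick 1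
  | gauss g, ω => (exec svd κ (g (ω 0)) fun i => ω (i + 1)).tick 1
  | topSV (p := p) (q := q) k hk B g, ω =>
      (exec svd κ (g (svd.topVectors p q k hk B)) ω).tick (κ * (p * q * min p q + q * k ^ 2))

/-! ### Matrix subroutines -/

/-- Run `f 0, …, f (n - 1)` one after the other and collect the results. -/
def forFin {V β : Type} : (n : ℕ) → (Fin n → RealProg V β) → RealProg V (Fin n → β)
  | 0, _ => pure Fin.elim0
  | n + 1, f => do
      let a ← f 0
      let as ← forFin n fun i => f i.succ
      pure (Fin.cons a as)

/-- The dot product. -/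
def dot {V : Type} : (n : ℕ) → (Fin n → V) → (Fin n → V) → RealProg V V
  | 0, _, _ => zero ret
  | n + 1, x, y => do
      let s ← dot n (fun i => x i.succ) (fun i => y i.succ)
      let t ← mul (x 0) (y 0) ret
      add t s ret

/-- The product of two matrices, entry by entry. -/
def matMul {V : Type} {p q r : ℕ} (A : Matrix (Fin p) (Fin q) V) (B : Matrix (Fin q) (Fin r) V) :
    RealProg V (Matrix (Fin p) (Fin r) V) :=
  forFin p fun i => forFin r fun j => dot q (fun l => A i l) (fun l => B l j)

/-- An `n × r` matrix of fresh standard Gaussians. -/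
def gaussianMatrix {V : Type} (n r : ℕ) : RealProg V (Matrix (Fin n) (Fin r) V) :=
  forFin n fun _ => forFin r fun _ => gauss ret

/-- Subtract from `v` its components along the vectors of a list, one after the other. -/
def removeComponents {V : Type} {m : ℕ} :
    List (Fin m → V) → (Fin m → V) → RealProg V (Fin m → V)
  | [], v => pure v
  | u :: us, v => do
      let c ← dot m u v
      let w ← forFin m fun i => do
        let t ← mul c (u i) ret
        sub (v i) t ret
      removeComponents us w

/-- Gram–Schmidt: extend the orthonormal list `Q` by the vectors of a second list, skipping those
which depend linearly on their predecessors. -/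
def gramSchmidt {V : Type} {m : ℕ} :
    List (Fin m → V) → List (Fin m → V) → RealProg V (List (Fin m → V))
  | Q, [] => pure Q
  | Q, y :: ys => do
      let v ← removeComponents Q y
      let s ← dot m v v
      let z ← isZero s ret
      if z then gramSchmidt Q ys
      else do
        let t ← sqrt s ret
        let u ← forFin m fun i => div (v i) t ret
        gramSchmidt (Q ++ [u]) ys

/-! ### Approximate SVD and feature extraction -/

/-- The number of columns of the Gaussian sketching matrix. -/
noncomputable def sketchSize (k : ℕ) (ε : ℝ) : ℕ :=
  k + ⌈(k : ℝ) / ε + 1⌉₊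

/-- `FastFrobeniusSVD(A, k, ε)`: sketch `Y = A R` with a Gaussian matrix `R`, compute an orthonormal
basis `Q` of the column space of `Y`, and return top `k` right singular vectors of `Qᵀ A`. -/
noncomputable def fastFrobeniusSVD {V : Type} {m n : ℕ} (A : Matrix (Fin m) (Fin n) V)
    (k : ℕ) (hk : k ≤ n) (ε : ℝ) : RealProg V (Matrix (Fin n) (Fin k) V) := do
  let R ← gaussianMatrix n (sketchSize k ε)
  let Y ← matMul A R
  let Q ← gramSchmidt [] (List.ofFn fun j => fun i => Y i j)
  let B ← matMul (Matrix.of fun (a : Fin Q.length) (i : Fin m) => Q.get a i) A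
  topSV k hk B ret

/-- Feature extraction: compute `Z = FastFrobeniusSVD(A, k, ε)` and return the `m × k` matrix
`C = A Z`. -/
noncomputable def featureExtraction {V : Type} {m n : ℕ} (A : Matrix (Fin m) (Fin n) V)
    (k : ℕ) (hk : k ≤ n) (ε : ℝ) : RealProg V (Matrix (Fin m) (Fin k) V) := do
  let Z ← fastFrobeniusSVD A k hk ε
  matMul A Z

end RealProg

/-- The law of the random tape: independent standard Gaussians. -/
noncomputable def gaussianTape : Measure (ℕ → ℝ) :=
  Measure.infinitePi fun _ => gaussianReal 0 1

/-! ### The Frobenius norm -/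

/-! Everything reduces to one inequality: `‖A - A Z Zᵀ‖² ≤ (1 + ε) F_opt(A)`. Given it, Pythagoras
along the columns of `Z` bounds the cost of a clustering on `A` by its cost on `A Z` plus `‖A - A Z
Zᵀ‖²`, while `F_opt(A Z) ≤ F_opt(A)` (`clusteringCost_le_of_features`).

The yardstick is not the best rank-`k` approximation of `A` but a projection `V₁ V₁ᵀ` onto a space
containing the rows of `Xᵀ A`, for `X` an optimal clustering. With `N = A - A V₁ V₁ᵀ` one has `‖N‖²
≤ F_opt(A)` (`exists_orthogonal_frobSq_le_optCost`). If `H` is a right inverse of `V₁ᵀ R`, then `A R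
H V₁ᵀ` is a competitor whose columns lie in the range of `Q`. Optimality of the top singular vectors
gives `‖A - A Z Zᵀ‖² ≤ ‖N‖² + ‖N R H‖²` (`frobSq_sub_topRightSingularVectors_le`).

The last term is random. Complete `V₁` to an orthogonal `V`; by rotation invariance `Vᵀ R` is again
Gaussian. Its first `k` rows `G` determine `H = Gᵀ (G Gᵀ)⁻¹`, and `N R` involves only the other,
independent rows. Hence `E‖N R H‖² ≤ ‖N‖² E tr (G Gᵀ)⁻¹`. A diagonal entry of `(G Gᵀ)⁻¹` is at most
the inverse squared distance of a row of `G` from the span of the others, an inverse chi-squared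
variable with `r - k + 1` degrees of freedom and mean `1 / (r - k - 1)`. The sketch size makes the
total at most `(ε / 100) ‖N‖²`, and Markov's inequality leaves failure probability `0.01`
(`gaussianMatrixLaw_good_sketch`).

For the running time, every stage costs `O(r m n)` with `r = O(k / ε)`. Gram–Schmidt stays within
this bound because the orthonormal list never exceeds `min m n` vectors. -/

theorem frobSq_nonneg {p q : ℕ} (M : Matrix (Fin p) (Fin q) ℝ) : 0 ≤ frobSq M :=
  Finset.sum_nonneg fun _ _ => Finset.sum_nonneg fun _ _ => sq_nonneg _

theorem frobSq_eq_trace {p q : ℕ} (M : Matrix (Fin p) (Fin q) ℝ) :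
    frobSq M = (M * M.transpose).trace := by
  simp [frobSq, Matrix.trace, Matrix.mul_apply, sq]

theorem frobSq_transpose {p q : ℕ} (M : Matrix (Fin p) (Fin q) ℝ) :
    frobSq M.transpose = frobSq M := by
  simp only [frobSq, Matrix.transpose_apply]
  exact Finset.sum_comm

theorem frobSq_add {p q : ℕ} (M N : Matrix (Fin p) (Fin q) ℝ) :
    frobSq (M + N) = frobSq M + frobSq N + 2 * (M * N.transpose).trace := by
  have h : (N * M.transpose).trace = (M * N.transpose).trace := by
    rw [← Matrix.trace_transpose, Matrix.transpose_mul, Matrix.transpose_transpose]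
  simp only [frobSq_eq_trace, Matrix.transpose_add, Matrix.add_mul, Matrix.mul_add,
    Matrix.trace_add, h]
  ring

theorem frobSq_neg {p q : ℕ} (M : Matrix (Fin p) (Fin q) ℝ) : frobSq (-M) = frobSq M := by
  simp [frobSq]

theorem frobSq_sub {p q : ℕ} (M N : Matrix (Fin p) (Fin q) ℝ) :
    frobSq (M - N) = frobSq M + frobSq N - 2 * (M * N.transpose).trace := by
  rw [sub_eq_add_neg, frobSq_add, frobSq_neg]
  simp [Matrix.transpose_neg]
  ring

theorem frobSq_mul_transpose_of_orthonormal {p q k : ℕ} (M : Matrix (Fin p) (Fin k) ℝ)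
    {Z : Matrix (Fin q) (Fin k) ℝ} (hZ : Z.transpose * Z = 1) :
    frobSq (M * Z.transpose) = frobSq M := by
  rw [frobSq_eq_trace, frobSq_eq_trace, Matrix.transpose_mul, Matrix.transpose_transpose,
    Matrix.mul_assoc, ← Matrix.mul_assoc Z.transpose, hZ, Matrix.one_mul]

theorem frobSq_mul_of_orthonormal {p q k : ℕ} (M : Matrix (Fin k) (Fin p) ℝ)
    {Z : Matrix (Fin q) (Fin k) ℝ} (hZ : Z.transpose * Z = 1) :
    frobSq (Z * M) = frobSq M := by
  rw [← frobSq_transpose, Matrix.transpose_mul, frobSq_mul_transpose_of_orthonormal _ hZ,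
    frobSq_transpose]

theorem frobSq_sub_mul_transpose {p q k : ℕ} (A : Matrix (Fin p) (Fin q) ℝ)
    {Z : Matrix (Fin q) (Fin k) ℝ} (hZ : Z.transpose * Z = 1) :
    frobSq (A - A * Z * Z.transpose) = frobSq A - frobSq (A * Z) := by
  rw [frobSq_sub, frobSq_mul_transpose_of_orthonormal _ hZ]
  have : A * (A * Z * Z.transpose).transpose = (A * Z) * (A * Z).transpose := by
    simp only [Matrix.transpose_mul, Matrix.transpose_transpose, Matrix.mul_assoc]
  rw [this, ← frobSq_eq_trace]
  ring

theorem frobSq_mul_le {p q k : ℕ} (A : Matrix (Fin p) (Fin q) ℝ)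
    {Z : Matrix (Fin q) (Fin k) ℝ} (hZ : Z.transpose * Z = 1) :
    frobSq (A * Z) ≤ frobSq A := by
  have h := frobSq_sub_mul_transpose A hZ
  have h' := frobSq_nonneg (A - A * Z * Z.transpose)
  linarith

theorem frobSq_sub_mul_transpose_le {p q k : ℕ} (A : Matrix (Fin p) (Fin q) ℝ)
    {Z : Matrix (Fin q) (Fin k) ℝ} (hZ : Z.transpose * Z = 1) :
    frobSq (A - A * Z * Z.transpose) ≤ frobSq A := by
  have h := frobSq_sub_mul_transpose A hZ
  have h' := frobSq_nonneg (A * Z)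
  linarith

theorem frobSq_transpose_mul_le {p q k : ℕ} (A : Matrix (Fin p) (Fin q) ℝ)
    {Q : Matrix (Fin p) (Fin k) ℝ} (hQ : Q.transpose * Q = 1) :
    frobSq (Q.transpose * A) ≤ frobSq A := by
  rw [← frobSq_transpose, Matrix.transpose_mul, Matrix.transpose_transpose, ← frobSq_transpose A]
  exact frobSq_mul_le _ hQ

theorem frobSq_sub_projection_mul_le {p q k : ℕ} (A : Matrix (Fin p) (Fin q) ℝ)
    {X : Matrix (Fin p) (Fin k) ℝ} (hX : X.transpose * X = 1) :
    frobSq (A - X * X.transpose * A) ≤ frobSq A := by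
  have h := frobSq_sub_mul_transpose_le A.transpose hX
  rw [← frobSq_transpose, frobSq_transpose A] at h
  simpa [Matrix.mul_assoc] using h

/-- A matrix `Q S V₁ᵀ` approximates `A` at best as well as the one with `S = Qᵀ A V₁`. -/
theorem frobSq_sub_le_frobSq_sub_mul_mul {p n q k : ℕ} (A : Matrix (Fin p) (Fin n) ℝ)
    {Q : Matrix (Fin p) (Fin q) ℝ} {V : Matrix (Fin n) (Fin k) ℝ} (S : Matrix (Fin q) (Fin k) ℝ)
    (hQ : Q.transpose * Q = 1) (hV : V.transpose * V = 1) :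
    frobSq A - frobSq (Q.transpose * A * V) ≤ frobSq (A - Q * S * V.transpose) := by
  -- Expanding this square is the whole inequality: the optimal coefficient matrix is `Qᵀ A V`.
  have h := frobSq_nonneg (Q.transpose * A * V - S)
  rw [frobSq_sub] at h ⊢
  rw [frobSq_mul_transpose_of_orthonormal _ hV, frobSq_mul_of_orthonormal _ hQ]
  have e : (A * (Q * S * V.transpose).transpose).trace
      = (Q.transpose * A * V * S.transpose).trace := by
    simp only [Matrix.transpose_mul, Matrix.transpose_transpose]
    rw [← Matrix.mul_assoc, ← Matrix.mul_assoc, Matrix.trace_mul_comm]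
    simp only [Matrix.mul_assoc]
  rw [e]
  linarith

/-! ### Optimality of top singular vectors -/

theorem Fin.sum_castLE {n k : ℕ} (hk : k ≤ n) (f : Fin n → ℝ) :
    ∑ j : Fin k, f (Fin.castLE hk j) = ∑ i : Fin n, if i.1 < k then f i else 0 := by
  rw [← Finset.sum_filter]
  refine Finset.sum_bij (fun j _ => Fin.castLE hk j) ?_ ?_ ?_ ?_
  · intro j _; simp
  · intro a _ b _ h; exact Fin.castLE_injective hk h
  · intro i hi
    exact ⟨⟨i.1, by simpa using hi⟩, Finset.mem_univ _, rfl⟩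
  · intro _ _; rfl

/-- `1 - W Wᵀ` is an orthogonal projection, so it equals `P Pᵀ` and has a nonnegative diagonal. -/
theorem mul_transpose_self_diag_le_one {n k : ℕ} {W : Matrix (Fin n) (Fin k) ℝ}
    (hW : W.transpose * W = 1) (i : Fin n) : ∑ j, W i j ^ 2 ≤ 1 := by
  set P := 1 - W * W.transpose with hP
  have hsymm : P.transpose = P := by simp [hP]
  have hidem : P * P.transpose = P := by
    rw [hsymm]
    simp only [hP, Matrix.sub_mul, Matrix.mul_sub, Matrix.one_mul, Matrix.mul_one]
    rw [Matrix.mul_assoc W, ← Matrix.mul_assoc W.transpose, hW, Matrix.one_mul]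
    simp
  have h1 : P i i = 1 - ∑ j, W i j ^ 2 := by
    simp [hP, Matrix.mul_apply, sq]
  have h2 : 0 ≤ P i i := by
    rw [← hidem, Matrix.mul_apply]
    exact Finset.sum_nonneg fun j _ => mul_self_nonneg _
  linarith

/-- Weights in `[0, 1]` of total mass `k` do best when concentrated on the `k` largest values. -/
theorem sum_mul_le_sum_castLE {n k : ℕ} (hk0 : 0 < k) (hk : k ≤ n) {a w : Fin n → ℝ}
    (ha : Antitone a) (hw0 : ∀ i, 0 ≤ w i) (hw1 : ∀ i, w i ≤ 1) (hw : ∑ i, w i = k) :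
    ∑ i, a i * w i ≤ ∑ j : Fin k, a (Fin.castLE hk j) := by
  rw [Fin.sum_castLE hk a]
  have hc : ∑ i : Fin n, (if i.1 < k then (1 : ℝ) else 0) = k := by
    rw [← Fin.sum_castLE hk fun _ => 1]; simp
  -- The `k`-th largest value is a threshold: moving mass from an index at or beyond `k` to one
  -- before it never loses, and the total mass moved is zero.
  set t := a ⟨k - 1, by omega⟩
  have key : ∀ i : Fin n, t * ((if i.1 < k then (1 : ℝ) else 0) - w i)
      ≤ (if i.1 < k then a i else 0) - a i * w i := by
    intro i
    split_ifs with hi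
    · have : t ≤ a i := ha (Fin.mk_le_mk.2 (by omega) : i ≤ ⟨k - 1, by omega⟩)
      nlinarith [hw1 i]
    · have : a i ≤ t := ha (Fin.mk_le_mk.2 (by omega) : (⟨k - 1, by omega⟩ : Fin n) ≤ i)
      nlinarith [hw0 i]
  have h := Finset.sum_le_sum fun i (_ : i ∈ Finset.univ) => key i
  rw [← Finset.mul_sum, Finset.sum_sub_distrib, Finset.sum_sub_distrib, hc, hw, sub_self,
    mul_zero] at h
  linarith

namespace IsTopRightSingularVectors

theorem transpose_mul_self {p q k : ℕ} {hk : k ≤ q} {B : Matrix (Fin p) (Fin q) ℝ}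
    {Z : Matrix (Fin q) (Fin k) ℝ} (h : IsTopRightSingularVectors hk B Z) :
    Z.transpose * Z = 1 := by
  obtain ⟨V, s, hV, -, -, -, hZ⟩ := h
  ext i j
  have := congrFun (congrFun hV (Fin.castLE hk i)) (Fin.castLE hk j)
  rw [Matrix.mul_apply, Matrix.one_apply] at this ⊢
  simpa [hZ, (Fin.castLE_injective hk).eq_iff] using this

/-- Top singular vectors capture the largest possible part of the Frobenius norm. -/
theorem frobSq_mul_le {p q k : ℕ} {hk : k ≤ q} (hk0 : 0 < k) {B : Matrix (Fin p) (Fin q) ℝ}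
    {Z : Matrix (Fin q) (Fin k) ℝ} (h : IsTopRightSingularVectors hk B Z)
    {V₁ : Matrix (Fin q) (Fin k) ℝ} (hV₁ : V₁.transpose * V₁ = 1) :
    frobSq (B * V₁) ≤ frobSq (B * Z) := by
  obtain ⟨V, s, hV, hs, hs0, hB, hZ⟩ := h
  have hV' : V * V.transpose = 1 := mul_eq_one_comm.1 hV
  have hD : (B * V).transpose * (B * V) = Matrix.diagonal fun i => s i ^ 2 := by
    rw [Matrix.transpose_mul, Matrix.mul_assoc, ← Matrix.mul_assoc B.transpose, hB,
      ← Matrix.mul_assoc, hV, Matrix.one_mul]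
  -- In the basis of singular vectors, the squared row norms of `W` are the weights with which `‖B
  -- V₁‖²` averages the squared singular values.
  obtain ⟨W, hWdef⟩ : ∃ W, W = V.transpose * V₁ := ⟨_, rfl⟩
  have hW : W.transpose * W = 1 := by
    rw [hWdef, Matrix.transpose_mul, Matrix.transpose_transpose, Matrix.mul_assoc,
      ← Matrix.mul_assoc V, hV', Matrix.one_mul, hV₁]
  have e1 : frobSq (B * V₁) = ∑ i, s i ^ 2 * ∑ j, W i j ^ 2 := by
    have : B * V₁ = B * V * W := by
      rw [hWdef, Matrix.mul_assoc, ← Matrix.mul_assoc V, hV', Matrix.one_mul]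
    rw [this, ← frobSq_transpose, frobSq_eq_trace, Matrix.transpose_transpose,
      Matrix.transpose_mul (B * V) W, Matrix.mul_assoc, ← Matrix.mul_assoc (B * V).transpose, hD]
    simp only [Finset.mul_sum]
    rw [Finset.sum_comm, Matrix.trace]
    refine Finset.sum_congr rfl fun j _ => ?_
    rw [Matrix.diag_apply, Matrix.mul_apply]
    refine Finset.sum_congr rfl fun i _ => ?_
    rw [Matrix.diagonal_mul, Matrix.transpose_apply]
    ring
  have e2 : frobSq (B * Z) = ∑ j : Fin k, s (Fin.castLE hk j) ^ 2 := by
    simp only [frobSq]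
    rw [Finset.sum_comm]
    refine Finset.sum_congr rfl fun j _ => ?_
    have := congrFun (congrFun hD (Fin.castLE hk j)) (Fin.castLE hk j)
    rw [Matrix.diagonal_apply_eq, Matrix.mul_apply] at this
    rw [← this]
    refine Finset.sum_congr rfl fun i _ => ?_
    rw [Matrix.transpose_apply, sq]
    simp only [Matrix.mul_apply, hZ]
  rw [e1, e2]
  refine sum_mul_le_sum_castLE hk0 hk (a := fun i => s i ^ 2)
    (fun i j hij => pow_le_pow_left₀ (hs0 j) (hs hij) 2)
    (fun i => Finset.sum_nonneg fun j _ => sq_nonneg _)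
    (mul_transpose_self_diag_le_one hW) ?_
  have : frobSq W = k := by
    rw [← frobSq_transpose, frobSq_eq_trace, Matrix.transpose_transpose, hW]; simp
  exact this

end IsTopRightSingularVectors

/-- The deterministic error bound for sketching: `R` is the sketching matrix, `Q` an orthonormal
basis of a space that contains the columns of `A R`, and `V₁` any orthonormal system for which
`V₁ᵀ R` has the right inverse `H`. -/
theorem frobSq_sub_topRightSingularVectors_le {m n k q r : ℕ} {hk : k ≤ n} (hk0 : 0 < k)
    (A : Matrix (Fin m) (Fin n) ℝ) {R : Matrix (Fin n) (Fin r) ℝ} {Q : Matrix (Fin m) (Fin q) ℝ}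
    {T : Matrix (Fin q) (Fin r) ℝ} (hQ : Q.transpose * Q = 1) (hT : Q * T = A * R)
    {Z : Matrix (Fin n) (Fin k) ℝ} (hZ : IsTopRightSingularVectors hk (Q.transpose * A) Z)
    {V₁ : Matrix (Fin n) (Fin k) ℝ} (hV₁ : V₁.transpose * V₁ = 1)
    {H : Matrix (Fin r) (Fin k) ℝ} (hH : V₁.transpose * R * H = 1) :
    frobSq (A - A * Z * Z.transpose) ≤ frobSq (A - A * V₁ * V₁.transpose)
      + frobSq ((A - A * V₁ * V₁.transpose) * R * H) := by
  have h1 := frobSq_sub_mul_transpose A hZ.transpose_mul_self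
  have h2 := frobSq_transpose_mul_le (A * Z) hQ
  have h3 := hZ.frobSq_mul_le hk0 hV₁
  -- The competitor `Q (T H) V₁ᵀ` equals `A R H V₁ᵀ`.
  have h4 := frobSq_sub_le_frobSq_sub_mul_mul A (T * H) hQ hV₁
  rw [← Matrix.mul_assoc] at h2
  set N := A - A * V₁ * V₁.transpose with hN
  have h5 : A - Q * (T * H) * V₁.transpose = N - N * R * H * V₁.transpose := by
    have : N * R * H = A * R * H - A * V₁ := by
      rw [hN, Matrix.sub_mul, Matrix.sub_mul, Matrix.mul_assoc (A * V₁),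
        Matrix.mul_assoc (A * V₁), hH, Matrix.mul_one]
    rw [this, Matrix.sub_mul, ← Matrix.mul_assoc Q, hT, hN]
    abel
  -- The rows of `N` are orthogonal to the columns of `V₁`, so the cross term in `h7` vanishes.
  have h6 : N * V₁ = 0 := by
    rw [hN, Matrix.sub_mul, Matrix.mul_assoc (A * V₁), hV₁, Matrix.mul_one, sub_self]
  have h7 : frobSq (N - N * R * H * V₁.transpose) = frobSq N + frobSq (N * R * H) := by
    rw [frobSq_sub, frobSq_mul_transpose_of_orthonormal _ hV₁, Matrix.transpose_mul,
      Matrix.transpose_transpose, ← Matrix.mul_assoc, h6, Matrix.zero_mul]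
    simp
  rw [h5, h7] at h4
  linarith

/-! ### Orthogonal complements -/

/-- Gram–Schmidt on the rows of `C`, padded with zero vectors: by triangularity the basis vectors of
index at least `p` are orthogonal to all rows. It serves both for the row space of the clustered
data and for the complement of the other rows of a Gaussian matrix. -/
theorem exists_orthogonal_mul_eq_zero {p n : ℕ} (hp : p ≤ n) (C : Matrix (Fin p) (Fin n) ℝ) :
    ∃ V : Matrix (Fin n) (Fin n) ℝ, V.transpose * V = 1 ∧
      ∀ i j, p ≤ j.1 → (C * V) i j = 0 := by
  classical
  let f : Fin n → EuclideanSpace ℝ (Fin n) := fun i =>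
    if h : i.1 < p then WithLp.toLp 2 (C ⟨i.1, h⟩) else 0
  have hcard : Module.finrank ℝ (EuclideanSpace ℝ (Fin n)) = Fintype.card (Fin n) := by simp
  let b := InnerProductSpace.gramSchmidtOrthonormalBasis hcard f
  refine ⟨Matrix.of fun i j => (b j).ofLp i, ?_, ?_⟩
  · ext i j
    have h := (orthonormal_iff_ite.1 b.orthonormal) i j
    rw [EuclideanSpace.inner_eq_star_dotProduct] at h
    simp only [dotProduct, star_trivial] at h
    rw [Matrix.mul_apply, Matrix.one_apply, ← h]
    exact Finset.sum_congr rfl fun a _ => by simp [mul_comm]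
  · intro i j hj
    have h := InnerProductSpace.gramSchmidtOrthonormalBasis_inv_triangular hcard f
      (i := Fin.castLE hp i) (j := j) (Fin.mk_lt_mk.2 (lt_of_lt_of_le i.2 hj))
    rw [EuclideanSpace.inner_eq_star_dotProduct] at h
    simpa [f, dotProduct, Matrix.mul_apply] using h

/-- The discarded columns of `V` contribute nothing to `C V Vᵀ = C`. -/
theorem mul_submatrix_mul_transpose {p n k : ℕ} (hk : k ≤ n) (C : Matrix (Fin p) (Fin n) ℝ)
    {V : Matrix (Fin n) (Fin n) ℝ} (hV : V.transpose * V = 1)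
    (hC : ∀ i j, k ≤ j.1 → (C * V) i j = 0) :
    C * V.submatrix id (Fin.castLE hk) * (V.submatrix id (Fin.castLE hk)).transpose = C := by
  have hV' : V * V.transpose = 1 := mul_eq_one_comm.1 hV
  ext i j
  conv_rhs => rw [← Matrix.mul_one C, ← hV', ← Matrix.mul_assoc, Matrix.mul_apply]
  rw [Matrix.mul_apply]
  have := Fin.sum_castLE hk fun l => (C * V) i l * V j l
  simp only [Matrix.transpose_apply]
  refine Eq.trans ?_ (this.trans ?_)
  · exact Finset.sum_congr rfl fun l _ => rfl
  · refine Finset.sum_congr rfl fun l _ => ?_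
    split_ifs with h
    · rfl
    · rw [hC i l (not_lt.1 h), zero_mul]

theorem submatrix_transpose_mul {n k : ℕ} (hk : k ≤ n) {V : Matrix (Fin n) (Fin n) ℝ}
    (hV : V.transpose * V = 1) : (V.submatrix id (Fin.castLE hk)).transpose * V
      = (1 : Matrix (Fin n) (Fin n) ℝ).submatrix (Fin.castLE hk) id := by
  rw [← hV]; rfl

theorem submatrix_orthonormal {n k : ℕ} (hk : k ≤ n) {V : Matrix (Fin n) (Fin n) ℝ}
    (hV : V.transpose * V = 1) :
    (V.submatrix id (Fin.castLE hk)).transpose * V.submatrix id (Fin.castLE hk) = 1 := by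
  have : (V.submatrix id (Fin.castLE hk)).transpose * V.submatrix id (Fin.castLE hk)
      = (V.transpose * V).submatrix (Fin.castLE hk) (Fin.castLE hk) := rfl
  rw [this, hV, Matrix.submatrix_one _ (Fin.castLE_injective hk)]

/-! ### Clusterings -/

theorem IsClusterIndicator.transpose_mul_self {m k : ℕ} {X : Matrix (Fin m) (Fin k) ℝ}
    (hX : IsClusterIndicator X) : X.transpose * X = 1 := by
  obtain ⟨σ, hσ, hX⟩ := hX
  ext i j
  simp only [Matrix.mul_apply, Matrix.transpose_apply, hX, Matrix.one_apply]
  by_cases hij : i = j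
  · subst hij
    obtain ⟨a, ha⟩ := hσ i
    have hpos : (0 : ℝ) < ((Finset.univ.filter fun a => σ a = i).card : ℝ) := by
      exact_mod_cast Finset.card_pos.2 ⟨a, by simp [ha]⟩
    have : ∀ x, ((if σ x = i then 1 / Real.sqrt ((Finset.univ.filter fun a => σ a = i).card : ℝ)
        else 0) * if σ x = i then 1 / Real.sqrt ((Finset.univ.filter fun a => σ a = i).card : ℝ)
        else 0) = if σ x = i then 1 / ((Finset.univ.filter fun a => σ a = i).card : ℝ) else 0 := by
      intro x
      split_ifs
      · rw [div_mul_div_comm, one_mul, Real.mul_self_sqrt hpos.le]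
      · simp
    simp only [this, if_true]
    rw [← Finset.sum_filter, Finset.sum_const, nsmul_eq_mul, mul_one_div_cancel hpos.ne']
  · rw [if_neg hij]
    refine Finset.sum_eq_zero fun x _ => ?_
    by_cases h : σ x = i
    · rw [if_neg (c := σ x = j) (by rw [h]; exact hij), mul_zero]
    · rw [if_neg h, zero_mul]

theorem optCost_nonneg {m n k : ℕ} (A : Matrix (Fin m) (Fin n) ℝ) : 0 ≤ optCost A k :=
  Real.sInf_nonneg (by rintro _ ⟨X, -, rfl⟩; exact frobSq_nonneg _)

/-- Some rank-`k` projection onto leading columns of an orthogonal matrix is at least as good as the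
optimal clustering. -/
theorem exists_orthogonal_frobSq_le_optCost {m n k : ℕ} (hk : 1 ≤ k) (hkm : k ≤ m) (hkn : k ≤ n)
    (A : Matrix (Fin m) (Fin n) ℝ) :
    ∃ V : Matrix (Fin n) (Fin n) ℝ, V.transpose * V = 1 ∧
      frobSq (A - A * V.submatrix id (Fin.castLE hkn)
        * (V.submatrix id (Fin.castLE hkn)).transpose) ≤ optCost A k := by
  obtain ⟨X, hX, hcost⟩ := (isLeast_optCost hk hkm A).1
  -- Since `Xᵀ A` is fixed by `V₁ V₁ᵀ`, the residual `A (1 - V₁ V₁ᵀ)` equals `(A - X Xᵀ A) (1 - V₁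
  -- V₁ᵀ)`, and the projection only shrinks it.
  obtain ⟨V, hV, hC⟩ := exists_orthogonal_mul_eq_zero hkn (X.transpose * A)
  refine ⟨V, hV, ?_⟩
  rw [← hcost, clusteringCost]
  have h1 := mul_submatrix_mul_transpose hkn _ hV hC
  have h2 := frobSq_sub_mul_transpose_le (A - X * X.transpose * A) (submatrix_orthonormal hkn hV)
  refine le_of_eq_of_le (congrArg _ ?_) h2
  rw [Matrix.sub_mul, Matrix.sub_mul, Matrix.mul_assoc X, Matrix.mul_assoc X, Matrix.mul_assoc X,
    h1]
  abel

/-- Clustering the features `A Z` instead of `A`. -/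
theorem clusteringCost_le_of_features {m n k : ℕ} (hk : 1 ≤ k) (hkm : k ≤ m)
    {A : Matrix (Fin m) (Fin n) ℝ} {Z : Matrix (Fin n) (Fin k) ℝ} (hZ : Z.transpose * Z = 1)
    {γ ε : ℝ} (hγ : 1 ≤ γ) (hε : 0 ≤ ε)
    (hE : frobSq (A - A * Z * Z.transpose) ≤ (1 + ε) * optCost A k)
    {X : Matrix (Fin m) (Fin k) ℝ} (hX : IsClusterIndicator X)
    (hcost : clusteringCost (A * Z) X ≤ γ * optCost (A * Z) k) :
    clusteringCost A X ≤ (1 + (1 + ε) * γ) * optCost A k := by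
  have hF := optCost_nonneg (k := k) A
  have h1 : optCost (A * Z) k ≤ optCost A k := by
    obtain ⟨X₀, hX₀, h₀⟩ := (isLeast_optCost hk hkm A).1
    refine ((isLeast_optCost hk hkm (A * Z)).2 ⟨X₀, hX₀, rfl⟩).trans ?_
    rw [← h₀, clusteringCost, clusteringCost, ← Matrix.mul_assoc, ← Matrix.sub_mul]
    exact frobSq_mul_le _ hZ
  have h2 : clusteringCost A X ≤ clusteringCost (A * Z) X + frobSq (A - A * Z * Z.transpose) := by
    -- Pythagoras splits the residual `A - X Xᵀ A` into its part along `Z`, which is the cost on `A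
    -- Z`, and a part to which `1 - X Xᵀ` is applied last.
    have e := frobSq_sub_mul_transpose (A - X * X.transpose * A) hZ
    have e' := frobSq_sub_projection_mul_le (A - A * Z * Z.transpose) hX.transpose_mul_self
    have e2 : A - X * X.transpose * A - (A - X * X.transpose * A) * Z * Z.transpose
        = A - A * Z * Z.transpose - X * X.transpose * (A - A * Z * Z.transpose) := by
      simp only [Matrix.sub_mul, Matrix.mul_sub, Matrix.mul_assoc]
      abel
    have e3 : (A - X * X.transpose * A) * Z = A * Z - X * X.transpose * (A * Z) := by
      rw [Matrix.sub_mul, Matrix.mul_assoc (X * X.transpose)]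
    rw [e2, e3] at e
    simp only [clusteringCost]
    linarith
  have h3 : γ * optCost (A * Z) k ≤ γ * optCost A k :=
    mul_le_mul_of_nonneg_left h1 (by linarith)
  -- The bounds add up to `γ + 1 + ε`, which falls short of the claimed factor by `ε (γ - 1)`.
  nlinarith [mul_nonneg hF (mul_nonneg hε (sub_nonneg.2 hγ))]

/-! ### Regularized inverse Gram matrices -/

/-- The regularization `δ` keeps the inverse meaningful when the Gram matrix is singular; this is
what later shows that singular Gram matrices have probability zero. -/
theorem isUnit_det_gram_add_smul {k r : ℕ} (G : Matrix (Fin k) (Fin r) ℝ) {δ : ℝ} (hδ : 0 < δ) :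
    IsUnit (G * G.transpose + δ • (1 : Matrix (Fin k) (Fin k) ℝ)).det := by
  have h1 : (G * G.transpose).PosSemidef := by
    simpa [Matrix.conjTranspose_eq_transpose_of_trivial] using
      Matrix.posSemidef_self_mul_conjTranspose G
  have h2 : (δ • (1 : Matrix (Fin k) (Fin k) ℝ)).PosDef := Matrix.PosDef.one.smul hδ
  exact (Matrix.PosDef.posSemidef_add h1 h2).det_pos.ne'.isUnit

/-- A diagonal entry of the regularized inverse Gram matrix is at most the inverse of the squared
norm of a projection of the corresponding row orthogonal to the other rows. -/
theorem gram_inv_diag_mul_le_one {k r : ℕ} (G : Matrix (Fin k) (Fin r) ℝ) {δ : ℝ} (hδ : 0 ≤ δ)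
    (hdet : IsUnit (G * G.transpose + δ • (1 : Matrix (Fin k) (Fin k) ℝ)).det)
    {U : Matrix (Fin r) (Fin r) ℝ} (hU : U.transpose * U = 1) (I : Finset (Fin r)) (j : Fin k)
    (horth : ∀ l, l ≠ j → ∀ i ∈ I, (G * U) l i = 0) :
    (G * G.transpose + δ • (1 : Matrix (Fin k) (Fin k) ℝ))⁻¹ j j * ∑ i ∈ I, (G * U) j i ^ 2 ≤ 1 := by
  set K := G * G.transpose + δ • (1 : Matrix (Fin k) (Fin k) ℝ) with hK
  -- Pairing `K c = e_j` with `c` gives `‖c G‖² + δ ‖c‖² = c_j`. On the coordinates in `I` only row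
  -- `j` contributes to `c G U`, whence `c_j² Σ ≤ c_j`.
  set c : Fin k → ℝ := fun l => K⁻¹ l j with hc
  have hKc : K.mulVec c = Pi.single j 1 := by
    have := Matrix.mul_nonsing_inv K hdet
    ext i
    have := congrFun (congrFun this i) j
    rw [Matrix.mul_apply, Matrix.one_apply] at this
    simp only [Matrix.mulVec, dotProduct, hc, this, Pi.single_apply]
  set h : Fin r → ℝ := Matrix.vecMul c G with hh
  have h1 : h ⬝ᵥ h + δ * (c ⬝ᵥ c) = c j := by
    have : c ⬝ᵥ K.mulVec c = c j := by rw [hKc]; simp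
    rw [← this, hK, Matrix.add_mulVec, dotProduct_add, Matrix.smul_mulVec, Matrix.one_mulVec,
      dotProduct_smul, smul_eq_mul, hh, ← Matrix.mulVec_mulVec, Matrix.dotProduct_mulVec c G,
      Matrix.mulVec_transpose]
  have h2 : (Matrix.vecMul h U) ⬝ᵥ (Matrix.vecMul h U) = h ⬝ᵥ h := by
    have hU' : U * U.transpose = 1 := mul_eq_one_comm.1 hU
    rw [← Matrix.mulVec_transpose U h, Matrix.dotProduct_mulVec, Matrix.vecMul_transpose,
      Matrix.mulVec_mulVec, hU', Matrix.one_mulVec]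
  have h3 : ∀ i ∈ I, Matrix.vecMul h U i = c j * (G * U) j i := by
    intro i hi
    rw [hh, Matrix.vecMul_vecMul, Matrix.vecMul, dotProduct,
      Finset.sum_eq_single j (fun l _ hl => by rw [horth l hl i hi, mul_zero]) (by simp)]
  have h4 : c j ^ 2 * ∑ i ∈ I, (G * U) j i ^ 2 ≤ c j := by
    calc c j ^ 2 * ∑ i ∈ I, (G * U) j i ^ 2 = ∑ i ∈ I, Matrix.vecMul h U i ^ 2 := by
          rw [Finset.mul_sum]
          exact Finset.sum_congr rfl fun i hi => by rw [h3 i hi]; ring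
      _ ≤ ∑ i, Matrix.vecMul h U i ^ 2 :=
          Finset.sum_le_sum_of_subset_of_nonneg (Finset.subset_univ _) fun _ _ _ => sq_nonneg _
      _ = h ⬝ᵥ h := by rw [← h2, dotProduct]; exact Finset.sum_congr rfl fun i _ => sq _
      _ ≤ c j := by
          have : 0 ≤ c ⬝ᵥ c := Finset.sum_nonneg fun i _ => mul_self_nonneg _
          nlinarith [mul_nonneg hδ this]
  change c j * _ ≤ 1
  rcases le_or_gt (c j) 0 with hcj | hcj
  · exact (mul_nonpos_of_nonpos_of_nonneg hcj
      (Finset.sum_nonneg fun i _ => sq_nonneg _)).trans zero_le_one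
  · refine le_of_mul_le_mul_left ?_ hcj
    nlinarith

theorem gram_inv_diag_nonneg {k r : ℕ} (G : Matrix (Fin k) (Fin r) ℝ) {δ : ℝ} (hδ : 0 < δ)
    (j : Fin k) : 0 ≤ (G * G.transpose + δ • (1 : Matrix (Fin k) (Fin k) ℝ))⁻¹ j j := by
  have h1 : (G * G.transpose).PosSemidef := by
    simpa [Matrix.conjTranspose_eq_transpose_of_trivial] using
      Matrix.posSemidef_self_mul_conjTranspose G
  exact (h1.add (Matrix.PosSemidef.one.smul hδ.le)).inv.diag_nonneg

/-- For a singular Gram matrix the regularized inverse has large trace. -/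
theorem one_div_le_trace_gram_inv {k r : ℕ} (G : Matrix (Fin k) (Fin r) ℝ)
    (hG : (G * G.transpose).det = 0) {δ : ℝ} (hδ : 0 < δ) :
    1 / δ ≤ ∑ j, (G * G.transpose + δ • (1 : Matrix (Fin k) (Fin k) ℝ))⁻¹ j j := by
  obtain ⟨v, hv0, hv⟩ := Matrix.exists_mulVec_eq_zero_iff.2 hG
  have hdet := isUnit_det_gram_add_smul G hδ
  set K := G * G.transpose + δ • (1 : Matrix (Fin k) (Fin k) ℝ) with hK
  have hvv : 0 < v ⬝ᵥ v := by
    have : 0 ≤ v ⬝ᵥ v := Finset.sum_nonneg fun i _ => mul_self_nonneg _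
    exact lt_of_le_of_ne this fun h => hv0 (dotProduct_self_eq_zero.1 h.symm)
  -- A kernel vector `v` of the Gram matrix satisfies `K v = δ v`. Cauchy–Schwarz against the `j`-th
  -- column of `K⁻¹` gives the entrywise bound, which is then summed over `j`.
  have key : ∀ j, v j ^ 2 ≤ K⁻¹ j j * (δ * (v ⬝ᵥ v)) := by
    intro j
    set c : Fin k → ℝ := fun l => K⁻¹ l j with hc
    have hKc : K.mulVec c = Pi.single j 1 := by
      have := Matrix.mul_nonsing_inv K hdet
      ext i
      have := congrFun (congrFun this i) j
      rw [Matrix.mul_apply, Matrix.one_apply] at this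
      simp only [Matrix.mulVec, dotProduct, hc, this, Pi.single_apply]
    have hKT : K.transpose = K := by simp [hK]
    have hKv : K.mulVec v = δ • v := by
      rw [hK, Matrix.add_mulVec, hv, zero_add, Matrix.smul_mulVec, Matrix.one_mulVec]
    have h1 : δ * (v ⬝ᵥ c) = v j := by
      have : v ⬝ᵥ K.mulVec c = v j := by rw [hKc]; simp
      rw [← this, Matrix.dotProduct_mulVec, ← Matrix.mulVec_transpose, hKT, hKv, smul_dotProduct,
        smul_eq_mul]
    have h2 : δ * (c ⬝ᵥ c) ≤ c j := by
      have : c ⬝ᵥ K.mulVec c = c j := by rw [hKc]; simp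
      rw [← this, hK, Matrix.add_mulVec, dotProduct_add, Matrix.smul_mulVec, Matrix.one_mulVec,
        dotProduct_smul, smul_eq_mul, ← Matrix.mulVec_mulVec, Matrix.dotProduct_mulVec c G,
        Matrix.mulVec_transpose]
      have : 0 ≤ Matrix.vecMul c G ⬝ᵥ Matrix.vecMul c G :=
        Finset.sum_nonneg fun i _ => mul_self_nonneg _
      linarith
    have h3 : (v ⬝ᵥ c) ^ 2 ≤ (v ⬝ᵥ v) * (c ⬝ᵥ c) := by
      have := Finset.sum_mul_sq_le_sq_mul_sq Finset.univ v c
      simpa only [dotProduct, ← sq] using this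
    have h4 : δ ^ 2 * (v ⬝ᵥ c) ^ 2 ≤ δ * (v ⬝ᵥ v) * (δ * (c ⬝ᵥ c)) := by nlinarith [sq_nonneg δ]
    have h5 : δ * (v ⬝ᵥ v) * (δ * (c ⬝ᵥ c)) ≤ δ * (v ⬝ᵥ v) * c j :=
      mul_le_mul_of_nonneg_left h2 (mul_pos hδ hvv).le
    calc v j ^ 2 = δ ^ 2 * (v ⬝ᵥ c) ^ 2 := by rw [← h1]; ring
      _ ≤ δ * (v ⬝ᵥ v) * c j := h4.trans h5
      _ = K⁻¹ j j * (δ * (v ⬝ᵥ v)) := mul_comm _ _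
  have hsum := Finset.sum_le_sum fun j (_ : j ∈ Finset.univ) => key j
  rw [← Finset.sum_mul] at hsum
  have e : ∑ j, v j ^ 2 = v ⬝ᵥ v := by simp [dotProduct, sq]
  rw [e] at hsum
  rw [div_le_iff₀ hδ]
  nlinarith

/-- `Hᵀ H = (G Gᵀ)⁻¹` for the right inverse `H`. In the singular case both sides vanish because `⁻¹`
is then zero. -/
theorem frobSq_right_inverse {k r : ℕ} (G : Matrix (Fin k) (Fin r) ℝ) :
    frobSq (G.transpose * (G * G.transpose)⁻¹) = ∑ j, (G * G.transpose)⁻¹ j j := by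
  have hs : ((G * G.transpose)⁻¹).transpose = (G * G.transpose)⁻¹ := by
    rw [Matrix.transpose_nonsing_inv]; simp
  rw [← frobSq_transpose, frobSq_eq_trace, Matrix.transpose_transpose, Matrix.transpose_mul,
    Matrix.transpose_transpose, hs, Matrix.mul_assoc, ← Matrix.mul_assoc G]
  by_cases h : IsUnit (G * G.transpose).det
  · rw [Matrix.mul_nonsing_inv _ h, Matrix.mul_one]; rfl
  · rw [Matrix.nonsing_inv_apply_not_isUnit _ h]; simp

/-! ### Gaussian vectors -/

/-- Rotation invariance, transported from the standard Gaussian of Euclidean space. -/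
theorem map_mulVec_pi_gaussian {r : ℕ} {U : Matrix (Fin r) (Fin r) ℝ} (hU : U.transpose * U = 1) :
    (Measure.pi fun _ : Fin r => gaussianReal 0 1).map (fun x => U.mulVec x)
      = Measure.pi fun _ : Fin r => gaussianReal 0 1 := by
  have hnorm : ∀ x : EuclideanSpace ℝ (Fin r), ‖Matrix.toEuclideanLin U x‖ = ‖x‖ := by
    intro x
    have e : ‖Matrix.toEuclideanLin U x‖ ^ 2 = ‖x‖ ^ 2 := by
      rw [EuclideanSpace.real_norm_sq_eq, EuclideanSpace.real_norm_sq_eq]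
      have h : U.mulVec x.ofLp ⬝ᵥ U.mulVec x.ofLp = x.ofLp ⬝ᵥ x.ofLp := by
        rw [Matrix.dotProduct_mulVec, ← Matrix.mulVec_transpose, Matrix.mulVec_mulVec, hU,
          Matrix.one_mulVec]
      simpa [dotProduct, ← sq, Matrix.toLpLin_apply] using h
    exact (sq_eq_sq₀ (norm_nonneg _) (norm_nonneg _)).1 e
  let f : EuclideanSpace ℝ (Fin r) ≃ₗᵢ[ℝ] EuclideanSpace ℝ (Fin r) :=
    LinearIsometry.toLinearIsometryEquiv ⟨Matrix.toEuclideanLin U, hnorm⟩ rfl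
  have h := stdGaussian_map f
  rw [← map_pi_eq_stdGaussian, Measure.map_map (by fun_prop) (by fun_prop)] at h
  have h2 := congrArg (Measure.map (WithLp.ofLp (p := 2) (V := Fin r → ℝ))) h
  rw [Measure.map_map (by fun_prop) (by fun_prop), Measure.map_map (by fun_prop) (by fun_prop)] at h2
  have e2 : (WithLp.ofLp ∘ WithLp.toLp 2 : (Fin r → ℝ) → (Fin r → ℝ)) = id := rfl
  rw [e2, Measure.map_id] at h2
  exact h2

theorem lintegral_exp_neg_mul_sq_gaussian {t : ℝ} (ht : 0 < t) :
    ∫⁻ x, ENNReal.ofReal (Real.exp (-(t * x ^ 2))) ∂gaussianReal 0 1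
      = ENNReal.ofReal ((1 + 2 * t) ^ (-(1 / 2) : ℝ)) := by
  have hint : Integrable (fun x : ℝ => Real.exp (-(t * x ^ 2))) (gaussianReal 0 1) := by
    refine Integrable.of_bound (C := 1) (by fun_prop) (Filter.Eventually.of_forall fun x => ?_)
    rw [Real.norm_eq_abs, abs_of_pos (Real.exp_pos _), Real.exp_le_one_iff]
    nlinarith [sq_nonneg x]
  rw [← ofReal_integral_eq_lintegral_ofReal hint
    (Filter.Eventually.of_forall fun x => (Real.exp_pos _).le),
    integral_gaussianReal_eq_integral_smul one_ne_zero]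
  congr 1
  have e : ∀ x : ℝ, gaussianPDFReal 0 1 x • Real.exp (-(t * x ^ 2))
      = (Real.sqrt (2 * Real.pi))⁻¹ * Real.exp (-(t + 1 / 2) * x ^ 2) := by
    intro x
    rw [gaussianPDFReal, smul_eq_mul, mul_assoc, ← Real.exp_add]
    simp only [NNReal.coe_one, mul_one, sub_zero]
    congr 2
    ring
  simp_rw [e]
  rw [integral_const_mul, integral_gaussian, Real.rpow_neg (by positivity), ← Real.sqrt_eq_rpow,
    ← Real.sqrt_inv, ← Real.sqrt_inv, ← Real.sqrt_mul (by positivity)]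
  congr 1
  field_simp
  ring

/-- Writing `1 / x` through exponentials lets independence factorize the mean of an inverse sum of
squares. At `x = 0` both sides are infinite. -/
theorem inv_eq_lintegral_exp_neg_mul {x : ℝ} (hx : 0 ≤ x) :
    (ENNReal.ofReal x)⁻¹ = ∫⁻ t in Set.Ioi (0 : ℝ), ENNReal.ofReal (Real.exp (-(t * x))) := by
  rcases hx.eq_or_lt with rfl | hx
  · simp
  · have h1 : ∀ t ∈ Set.Ioi (0 : ℝ), HasDerivAt (fun t => -(Real.exp (-(t * x)) / x))
        (Real.exp (-(t * x))) t := by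
      intro t _
      have := ((((hasDerivAt_id t).mul_const x).neg).exp.div_const x).neg
      refine this.congr_deriv ?_
      simp
      field_simp
    have h2 : ContinuousWithinAt (fun t => -(Real.exp (-(t * x)) / x)) (Set.Ici 0) 0 :=
      Continuous.continuousWithinAt (by fun_prop)
    have h3 : Filter.Tendsto (fun t => -(Real.exp (-(t * x)) / x)) Filter.atTop (nhds 0) := by
      have := (Real.tendsto_exp_neg_atTop_nhds_zero.comp
        (Filter.tendsto_id.atTop_mul_const hx)).div_const x |>.neg
      simpa using this
    have h4 := integrableOn_Ioi_deriv_of_nonneg h2 h1 (fun t _ => (Real.exp_pos _).le) h3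
    rw [← ofReal_integral_eq_lintegral_ofReal h4
      (Filter.Eventually.of_forall fun t => (Real.exp_pos _).le),
      integral_Ioi_of_hasDerivAt_of_tendsto h2 h1 h4 h3, ← ENNReal.ofReal_inv_of_pos hx]
    congr 1
    simp

theorem lintegral_one_add_two_mul_rpow {d : ℝ} (hd : 2 < d) :
    ∫⁻ t in Set.Ioi (0 : ℝ), ENNReal.ofReal ((1 + 2 * t) ^ (-(d / 2)))
      = ENNReal.ofReal (1 / (d - 2)) := by
  have h1 : ∀ t ∈ Set.Ioi (0 : ℝ), HasDerivAt (fun t => -((1 + 2 * t) ^ (-(d / 2 - 1)) / (d - 2)))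
      ((1 + 2 * t) ^ (-(d / 2))) t := by
    intro t ht
    have ht : 0 < 1 + 2 * t := by have := Set.mem_Ioi.1 ht; linarith
    have h0 : HasDerivAt (fun t : ℝ => 1 + 2 * t) 2 t := by
      simpa using ((hasDerivAt_id t).const_mul 2).const_add 1
    have := ((h0.rpow_const (p := -(d / 2 - 1)) (Or.inl ht.ne')).div_const (d - 2)).neg
    refine this.congr_deriv ?_
    have : (-(d / 2 - 1) - 1) = -(d / 2) := by ring
    rw [this]
    have : d - 2 ≠ 0 := by linarith
    field_simp
  have h2 : ContinuousWithinAt (fun t => -((1 + 2 * t) ^ (-(d / 2 - 1)) / (d - 2)))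
      (Set.Ici 0) 0 := by
    refine ContinuousAt.continuousWithinAt ?_
    refine ((ContinuousAt.rpow_const (by fun_prop) (Or.inl (by norm_num))).div_const _).neg
  have h3 : Filter.Tendsto (fun t => -((1 + 2 * t) ^ (-(d / 2 - 1)) / (d - 2)))
      Filter.atTop (nhds 0) := by
    have h0 : Filter.Tendsto (fun t : ℝ => 1 + 2 * t) Filter.atTop Filter.atTop :=
      Filter.tendsto_atTop_add_const_left _ _ (Filter.tendsto_id.const_mul_atTop two_pos)
    have := ((tendsto_rpow_neg_atTop (y := d / 2 - 1) (by linarith)).comp h0).div_const (d - 2)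
      |>.neg
    simpa using this
  have hpos : ∀ t ∈ Set.Ioi (0 : ℝ), 0 ≤ (1 + 2 * t) ^ (-(d / 2)) := by
    intro t ht
    have := Set.mem_Ioi.1 ht
    positivity
  have h4 := integrableOn_Ioi_deriv_of_nonneg h2 h1 hpos h3
  rw [← ofReal_integral_eq_lintegral_ofReal h4
    ((ae_restrict_iff' measurableSet_Ioi).2 (Filter.Eventually.of_forall hpos)),
    integral_Ioi_of_hasDerivAt_of_tendsto h2 h1 h4 h3]
  congr 1
  simp

theorem lintegral_pi_finset_prod {r : ℕ} (I : Finset (Fin r)) {f : ℝ → ENNReal}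
    (hf : Measurable f) :
    ∫⁻ y : Fin r → ℝ, ∏ i ∈ I, f (y i) ∂(Measure.pi fun _ => gaussianReal 0 1)
      = (∫⁻ x, f x ∂gaussianReal 0 1) ^ I.card := by
  have h := iIndepFun_pi (μ := fun _ : Fin r => gaussianReal 0 1) (X := fun _ => f)
    fun _ => hf.aemeasurable
  rw [lintegral_prod_eq_prod_lintegral_of_indepFun I (fun i (y : Fin r → ℝ) => f (y i)) h
    fun i => hf.comp (measurable_pi_apply i)]
  rw [Finset.prod_congr rfl (g := fun _ => ∫⁻ x, f x ∂gaussianReal 0 1), Finset.prod_const]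
  intro i _
  exact (measurePreserving_eval (fun _ : Fin r => gaussianReal 0 1) i).lintegral_comp hf

/-- The expectation of the inverse of a chi-squared variable with at least three degrees of
freedom. -/
theorem lintegral_inv_sum_sq_gaussian {r : ℕ} (I : Finset (Fin r)) (hI : 3 ≤ I.card) :
    ∫⁻ y : Fin r → ℝ, (ENNReal.ofReal (∑ i ∈ I, y i ^ 2))⁻¹
        ∂(Measure.pi fun _ => gaussianReal 0 1)
      = ENNReal.ofReal (1 / ((I.card : ℝ) - 2)) := by
  have hd : (2 : ℝ) < I.card := by exact_mod_cast hI
  rw [← lintegral_one_add_two_mul_rpow hd]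
  simp_rw [fun y : Fin r → ℝ =>
    inv_eq_lintegral_exp_neg_mul (Finset.sum_nonneg fun i (_ : i ∈ I) => sq_nonneg (y i))]
  -- By Tonelli the mean becomes an integral over `t` of the Laplace transform `(1 + 2 t) ^ (-d /
  -- 2)`, which is finite because `d > 2`.
  rw [lintegral_lintegral_swap]
  swap
  · refine Measurable.aemeasurable ?_
    unfold Function.uncurry
    fun_prop
  refine setLIntegral_congr_fun measurableSet_Ioi fun t ht => ?_
  have ht : 0 < t := ht
  have e : ∀ y : Fin r → ℝ, ENNReal.ofReal (Real.exp (-(t * ∑ i ∈ I, y i ^ 2)))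
      = ∏ i ∈ I, ENNReal.ofReal (Real.exp (-(t * y i ^ 2))) := by
    intro y
    rw [← ENNReal.ofReal_prod_of_nonneg fun i _ => (Real.exp_pos _).le, ← Real.exp_sum,
      Finset.mul_sum, Finset.sum_neg_distrib]
  simp only [e]
  rw [lintegral_pi_finset_prod I (f := fun x => ENNReal.ofReal (Real.exp (-(t * x ^ 2))))
    (by fun_prop), lintegral_exp_neg_mul_sq_gaussian ht, ← ENNReal.ofReal_pow (by positivity),
    ← Real.rpow_mul_natCast (by positivity)]
  congr 2
  ring

/-- The previous expectation for the components along some columns of an orthogonal matrix. -/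
theorem lintegral_inv_sum_sq_vecMul_gaussian {r : ℕ} {U : Matrix (Fin r) (Fin r) ℝ}
    (hU : U.transpose * U = 1) (I : Finset (Fin r)) (hI : 3 ≤ I.card) :
    ∫⁻ y : Fin r → ℝ, (ENNReal.ofReal (∑ i ∈ I, Matrix.vecMul y U i ^ 2))⁻¹
        ∂(Measure.pi fun _ => gaussianReal 0 1)
      = ENNReal.ofReal (1 / ((I.card : ℝ) - 2)) := by
  have hU' : U.transpose.transpose * U.transpose = 1 := by
    rw [Matrix.transpose_transpose]; exact mul_eq_one_comm.1 hU
  have hm : Measurable fun x : Fin r → ℝ => U.transpose.mulVec x :=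
    (Continuous.matrix_mulVec continuous_const continuous_id).measurable
  rw [← lintegral_inv_sum_sq_gaussian I hI]
  conv_rhs => rw [← map_mulVec_pi_gaussian hU', lintegral_map (by fun_prop) hm]
  simp_rw [Matrix.mulVec_transpose]

/-- Second moment of a sum of independent centred random variables. -/
theorem memLp_and_integral_sq_sum_pi {ι : Type*} [Fintype ι] {Ω : ι → Type*}
    {mΩ : ∀ i, MeasurableSpace (Ω i)} {μ : ∀ i, Measure (Ω i)} [∀ i, IsProbabilityMeasure (μ i)]
    {X : ∀ i, Ω i → ℝ} (hX : ∀ i, MemLp (X i) 2 (μ i)) (h0 : ∀ i, ∫ ω, X i ω ∂μ i = 0) :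
    MemLp (fun ω => ∑ i, X i (ω i)) 2 (Measure.pi μ) ∧
      ∫ ω, ∑ i, X i (ω i) ∂Measure.pi μ = 0 ∧
      ∫ ω, (∑ i, X i (ω i)) ^ 2 ∂Measure.pi μ = ∑ i, ∫ ω, X i ω ^ 2 ∂μ i := by
  have hX' : ∀ i, MemLp (fun ω : ∀ i, Ω i => X i (ω i)) 2 (Measure.pi μ) := fun i =>
    (hX i).comp_measurePreserving (measurePreserving_eval μ i)
  have hm : MemLp (fun ω => ∑ i, X i (ω i)) 2 (Measure.pi μ) :=
    memLp_finsetSum _ fun i _ => hX' i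
  have hi : ∫ ω, ∑ i, X i (ω i) ∂Measure.pi μ = 0 := by
    rw [integral_finsetSum _ fun i _ => (hX' i).integrable one_le_two]
    refine Finset.sum_eq_zero fun i _ => ?_
    rw [← h0 i]
    exact integral_comp_eval (hX i).aestronglyMeasurable
  refine ⟨hm, hi, ?_⟩
  have hv := variance_sum_pi hX
  have e : (∑ i, fun ω : ∀ i, Ω i => X i (ω i)) = fun ω => ∑ i, X i (ω i) := by
    ext ω; simp
  rw [e, variance_of_integral_eq_zero hm.aemeasurable hi] at hv
  rw [hv]
  exact Finset.sum_congr rfl fun i _ => variance_of_integral_eq_zero (hX i).aemeasurable (h0 i)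

theorem lintegral_sq_sum_gaussian {ι : Type*} [Fintype ι] {r : ℕ} (c : ι → Fin r → ℝ) :
    ∫⁻ y : ι → Fin r → ℝ, ENNReal.ofReal ((∑ l, ∑ a, c l a * y l a) ^ 2)
        ∂(Measure.pi fun _ => Measure.pi fun _ => gaussianReal 0 1)
      = ENNReal.ofReal (∑ l, ∑ a, c l a ^ 2) := by
  have h1 : ∀ x : ℝ, MemLp (fun y => x * y) 2 (gaussianReal 0 1) := fun x =>
    (memLp_id_gaussianReal 2).const_mul x
  have h2 : ∀ x : ℝ, ∫ y, x * y ∂gaussianReal 0 1 = 0 := fun x => by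
    rw [integral_const_mul, integral_id_gaussianReal, mul_zero]
  have h3 : ∀ x : ℝ, ∫ y, (x * y) ^ 2 ∂gaussianReal 0 1 = x ^ 2 := fun x => by
    have := variance_of_integral_eq_zero (h1 x).aemeasurable (h2 x)
    rw [← this, variance_const_mul, variance_fun_id_gaussianReal]
    simp
  have h4 := fun l => memLp_and_integral_sq_sum_pi (μ := fun _ : Fin r => gaussianReal 0 1)
    (X := fun a y => c l a * y) (fun a => h1 (c l a)) fun a => h2 (c l a)
  have h5 := memLp_and_integral_sq_sum_pi
    (μ := fun _ : ι => Measure.pi fun _ : Fin r => gaussianReal 0 1)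
    (X := fun l y => ∑ a, c l a * y a) (fun l => (h4 l).1) fun l => (h4 l).2.1
  rw [← ofReal_integral_eq_lintegral_ofReal h5.1.integrable_sq
    (Filter.Eventually.of_forall fun y => sq_nonneg _), h5.2.2]
  simp only [(h4 _).2.2, h3]

/-! ### Gaussian matrices -/

/-- The law of a matrix with independent standard Gaussian entries. -/
noncomputable abbrev gaussianMatrixLaw (n r : ℕ) : Measure (Fin n → Fin r → ℝ) :=
  Measure.pi fun _ => Measure.pi fun _ => gaussianReal 0 1

theorem gaussianMatrixLaw_eq_map_curry (n r : ℕ) :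
    gaussianMatrixLaw n r
      = (Measure.infinitePi fun _ : Fin n × Fin r => gaussianReal 0 1).map Function.curry := by
  have h := Measure.infinitePi_map_curry (ι := Fin n) (κ := Fin r) (X := ℝ)
    fun _ _ => gaussianReal 0 1
  rw [MeasurableEquiv.coe_curry] at h
  rw [h]
  simp only [Measure.infinitePi_eq_pi]

/-- Injectivity says that distinct matrix entries read distinct tape cells. -/
theorem map_gaussianTape {n r : ℕ} {f : Fin n → Fin r → ℕ}
    (hf : Function.Injective (Function.uncurry f)) :
    gaussianTape.map (fun ω i j => ω (f i j)) = gaussianMatrixLaw n r := by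
  rw [gaussianMatrixLaw_eq_map_curry, gaussianTape,
    ← Measure.map_infinitePi_infinitePi_of_inj (P := fun _ : ℕ => gaussianReal 0 1) hf,
    Measure.map_map (by fun_prop) (by fun_prop)]
  rfl

theorem map_swap_gaussianMatrixLaw (n r : ℕ) :
    (gaussianMatrixLaw n r).map (fun R j i => R i j) = gaussianMatrixLaw r n := by
  rw [gaussianMatrixLaw_eq_map_curry, gaussianMatrixLaw_eq_map_curry,
    ← Measure.map_infinitePi_infinitePi_of_inj (P := fun _ : Fin n × Fin r => gaussianReal 0 1)
      (Prod.swap_injective (α := Fin r) (β := Fin n)),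
    Measure.map_map (by fun_prop) (by fun_prop), Measure.map_map (by fun_prop) (by fun_prop)]
  rfl

/-- `V` acts on each column separately, so the matrix is transposed to make the independent blocks
its columns. -/
theorem map_mul_gaussianMatrixLaw {n r : ℕ} {V : Matrix (Fin n) (Fin n) ℝ}
    (hV : V.transpose * V = 1) :
    (gaussianMatrixLaw n r).map (fun R i j => (V * Matrix.of R) i j)
      = gaussianMatrixLaw n r := by
  have hm : Measurable fun x : Fin n → ℝ => V.mulVec x :=
    (Continuous.matrix_mulVec continuous_const continuous_id).measurable
  have hm' : Measurable fun (R : Fin r → Fin n → ℝ) j => V.mulVec (R j) :=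
    measurable_pi_lambda _ fun j => hm.comp (measurable_pi_apply j)
  have hm2 : Measurable fun (R : Fin r → Fin n → ℝ) i j => R j i := by fun_prop
  have hm3 : Measurable fun (R : Fin n → Fin r → ℝ) i j => R j i := by fun_prop
  have h : (gaussianMatrixLaw r n).map (fun R j => V.mulVec (R j)) = gaussianMatrixLaw r n := by
    have : ∀ _ : Fin r, SigmaFinite ((Measure.pi fun _ : Fin n => gaussianReal 0 1).map
        fun x => V.mulVec x) := fun _ => by
      rw [map_mulVec_pi_gaussian hV]; infer_instance
    rw [Measure.pi_map_pi fun _ => hm.aemeasurable]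
    simp only [map_mulVec_pi_gaussian hV]
  rw [← map_swap_gaussianMatrixLaw n r, Measure.map_map hm' hm3] at h
  have h2 := congrArg (Measure.map fun (R : Fin r → Fin n → ℝ) i j => R j i) h
  rw [map_swap_gaussianMatrixLaw, map_swap_gaussianMatrixLaw,
    Measure.map_map hm2 (hm'.comp hm3)] at h2
  exact h2

/-- The first `k` rows of a matrix. -/
def topRows {n r k : ℕ} (hk : k ≤ n) (R : Fin n → Fin r → ℝ) : Matrix (Fin k) (Fin r) ℝ :=
  Matrix.of fun l => R (Fin.castLE hk l)

/-- A right inverse of the first `k` rows of a matrix, if these are linearly independent. -/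
noncomputable def topRowsInv {n r k : ℕ} (hk : k ≤ n) (R : Fin n → Fin r → ℝ) :
    Matrix (Fin r) (Fin k) ℝ :=
  (topRows hk R).transpose * (topRows hk R * (topRows hk R).transpose)⁻¹

theorem continuous_topRows {n r k : ℕ} (hk : k ≤ n) :
    Continuous (topRows hk : (Fin n → Fin r → ℝ) → Matrix (Fin k) (Fin r) ℝ) :=
  continuous_matrix fun i j => (continuous_apply_apply (Fin.castLE hk i) j)

theorem continuous_gram_topRows {n r k : ℕ} (hk : k ≤ n) :
    Continuous fun R : Fin n → Fin r → ℝ => topRows hk R * (topRows hk R).transpose :=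
  (continuous_topRows hk).matrix_mul (continuous_topRows hk).matrix_transpose

/-- Inversion is discontinuous at singular matrices, but it is the continuous adjugate times the
measurable inverse of the determinant. -/
theorem measurable_matrix_inv_apply {α : Type*} [TopologicalSpace α] [MeasurableSpace α]
    [BorelSpace α] {k : ℕ} {f : α → Matrix (Fin k) (Fin k) ℝ} (hf : Continuous f) (i j : Fin k) :
    Measurable fun x => (f x)⁻¹ i j := by
  simp only [Matrix.inv_def, Ring.inverse_eq_inv', Matrix.smul_apply, smul_eq_mul]
  exact hf.matrix_det.measurable.inv.mul (hf.matrix_adjugate.matrix_elem i j).measurable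

theorem measurable_topRowsInv_apply {n r k : ℕ} (hk : k ≤ n) (a : Fin r) (j : Fin k) :
    Measurable fun R : Fin n → Fin r → ℝ => topRowsInv hk R a j := by
  simp only [topRowsInv, Matrix.mul_apply (M := Matrix.transpose _)]
  refine Finset.measurable_sum _ fun l _ => Measurable.mul ?_ ?_
  · exact ((continuous_topRows hk).matrix_elem l a).measurable
  · exact measurable_matrix_inv_apply (continuous_gram_topRows hk) l j

theorem measurable_frobSq {α : Type*} [MeasurableSpace α] {p q : ℕ}
    {f : α → Matrix (Fin p) (Fin q) ℝ} (hf : ∀ i j, Measurable fun x => f x i j) :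
    Measurable fun x => frobSq (f x) :=
  Finset.measurable_sum _ fun i _ => Finset.measurable_sum _ fun j _ => (hf i j).pow_const 2

theorem measurable_frobSq_mul_topRowsInv {m n r k : ℕ} (hk : k ≤ n)
    (M : Matrix (Fin m) (Fin n) ℝ) :
    Measurable fun R : Fin n → Fin r → ℝ =>
      frobSq (M * Matrix.of R * topRowsInv hk R) := by
  refine measurable_frobSq fun i j => ?_
  simp only [Matrix.mul_apply]
  refine Finset.measurable_sum _ fun a _ => Measurable.mul ?_ (measurable_topRowsInv_apply hk a j)
  fun_prop

theorem measurable_gram_inv_diag {n r k : ℕ} (hk : k ≤ n) (δ : ℝ) (j : Fin k) :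
    Measurable fun R : Fin n → Fin r → ℝ =>
      ENNReal.ofReal ((topRows hk R * (topRows hk R).transpose
        + δ • (1 : Matrix (Fin k) (Fin k) ℝ))⁻¹ j j) :=
  (measurable_matrix_inv_apply ((continuous_gram_topRows hk).add continuous_const) j j).ennreal_ofReal

/-- The expected diagonal entries of the (regularized) inverse Gram matrix of a Gaussian matrix. -/
theorem lintegral_gram_inv_diag_le {n r k : ℕ} (hk : k ≤ n) (hr : k + 2 ≤ r) {δ : ℝ} (hδ : 0 ≤ δ)
    (j : Fin k) :
    ∫⁻ R, ENNReal.ofReal ((topRows hk R * (topRows hk R).transpose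
        + δ • (1 : Matrix (Fin k) (Fin k) ℝ))⁻¹ j j) ∂gaussianMatrixLaw n r
      ≤ ENNReal.ofReal (1 / ((r : ℝ) - k - 1)) := by
  -- From here on `k` counts the rows other than `j`.
  obtain ⟨k, rfl⟩ : ∃ k', k = k' + 1 := ⟨k - 1, by have := j.pos; omega⟩
  -- Only row `j` is integrated; all other rows stay fixed, so the rotation `U` below may depend on
  -- them.
  have hle := lintegral_le_of_lmarginal_le {Fin.castLE hk j}
    (measurable_gram_inv_diag (r := r) hk δ j)
    (measurable_const (a := ENNReal.ofReal (1 / ((r : ℝ) - ((k + 1 : ℕ) : ℝ) - 1))))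
    (μ := fun _ : Fin n => Measure.pi fun _ : Fin r => gaussianReal 0 1) ?_
  · refine hle.trans_eq ?_
    rw [lintegral_const, measure_univ, mul_one]
  rw [lmarginal_singleton, lmarginal_singleton]
  intro x
  obtain ⟨U, hU, hzero⟩ := exists_orthogonal_mul_eq_zero (p := k) (by omega)
    ((topRows hk x).submatrix j.succAbove id)
  -- These `r - k` coordinates in the rotated frame are orthogonal to all the other rows.
  let I : Finset (Fin r) := Finset.Ici ⟨k, by omega⟩
  have hI : I.card = r - k := by simp [I]
  have hbound : ∀ y : Fin r → ℝ,
      ENNReal.ofReal ((topRows hk (Function.update x (Fin.castLE hk j) y)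
        * (topRows hk (Function.update x (Fin.castLE hk j) y)).transpose
        + δ • (1 : Matrix (Fin (k + 1)) (Fin (k + 1)) ℝ))⁻¹ j j)
      ≤ (ENNReal.ofReal (∑ i ∈ I, Matrix.vecMul y U i ^ 2))⁻¹ := by
    intro y
    set G := topRows hk (Function.update x (Fin.castLE hk j) y) with hG
    by_cases hdet : IsUnit (G * G.transpose + δ • (1 : Matrix (Fin (k + 1)) (Fin (k + 1)) ℝ)).det
    · have hrow : ∀ i, (G * U) j i = Matrix.vecMul y U i := by
        intro i
        simp [hG, topRows, Matrix.mul_apply, Matrix.vecMul, dotProduct]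
      have horth : ∀ l, l ≠ j → ∀ i ∈ I, (G * U) l i = 0 := by
        intro l hl i hi
        obtain ⟨l', rfl⟩ := Fin.exists_succAbove_eq hl
        have h0 := hzero l' i (by simpa [I, Fin.le_def] using hi)
        rw [← h0, Matrix.mul_apply, Matrix.mul_apply]
        refine Finset.sum_congr rfl fun a _ => ?_
        have : Fin.castLE hk (j.succAbove l') ≠ Fin.castLE hk j := fun h =>
          hl (Fin.castLE_injective hk h)
        simp [hG, topRows, this]
      have h := gram_inv_diag_mul_le_one G hδ hdet hU I j horth
      rw [ENNReal.le_inv_iff_mul_le,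
        ← ENNReal.ofReal_mul' (Finset.sum_nonneg fun i _ => sq_nonneg _)]
      simp only [hrow] at h
      exact ENNReal.ofReal_le_one.2 h
    -- Singular matrices, possible when `δ = 0`, have inverse zero by convention.
    · rw [Matrix.nonsing_inv_apply_not_isUnit _ hdet]
      simp
  refine (lintegral_mono hbound).trans ?_
  rw [lintegral_inv_sum_sq_vecMul_gaussian hU I (by omega), lintegral_const, measure_univ, mul_one,
    hI, Nat.cast_sub (by omega)]
  refine le_of_eq ?_
  congr 2
  push_cast
  ring

theorem lintegral_trace_gram_inv_le {n r k : ℕ} (hk : k ≤ n) (hr : k + 2 ≤ r) {δ : ℝ}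
    (hδ : 0 ≤ δ) :
    ∫⁻ R, ∑ j, ENNReal.ofReal ((topRows hk R * (topRows hk R).transpose
        + δ • (1 : Matrix (Fin k) (Fin k) ℝ))⁻¹ j j) ∂gaussianMatrixLaw n r
      ≤ ENNReal.ofReal (k / ((r : ℝ) - k - 1)) := by
  rw [lintegral_finsetSum _ fun j _ => measurable_gram_inv_diag hk δ j]
  refine (Finset.sum_le_sum fun j _ => lintegral_gram_inv_diag_le hk hr hδ j).trans ?_
  rw [Finset.sum_const, Finset.card_univ, Fintype.card_fin, nsmul_eq_mul,
    ← ENNReal.ofReal_natCast, ← ENNReal.ofReal_mul (Nat.cast_nonneg k), mul_one_div]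

/-- The mean trace of the regularized inverse is bounded uniformly in `δ`, but on the singular event
the trace is at least `1 / δ`. Taking `δ = 1 / N` with `N` large contradicts positive probability.
-/
theorem gaussianMatrixLaw_det_gram_eq_zero {n r k : ℕ} (hk : k ≤ n) (hr : k + 2 ≤ r) :
    gaussianMatrixLaw n r {R | (topRows hk R * (topRows hk R).transpose).det = 0} = 0 := by
  by_contra h0
  obtain ⟨N, hN⟩ := ENNReal.exists_nat_mul_gt h0
    (ENNReal.ofReal_ne_top (r := k / ((r : ℝ) - k - 1)))
  refine hN.not_ge ?_
  rcases Nat.eq_zero_or_pos N with rfl | hNpos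
  · simp
  have hδ : (0 : ℝ) < 1 / N := by positivity
  refine le_trans ?_ (lintegral_trace_gram_inv_le hk hr hδ.le)
  refine le_trans ?_ (mul_meas_ge_le_lintegral₀ (Measurable.aemeasurable
    (Finset.measurable_sum _ fun j _ => measurable_gram_inv_diag hk _ j)) N)
  refine mul_le_mul_right (measure_mono fun R hR => ?_) _
  have := one_div_le_trace_gram_inv (topRows hk R) hR hδ
  rw [one_div_one_div] at this
  rw [Set.mem_ofPred_eq, ← ENNReal.ofReal_sum_of_nonneg fun j _ => gram_inv_diag_nonneg _ hδ j,
    ← ENNReal.ofReal_natCast]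
  exact ENNReal.ofReal_le_ofReal this

/-- With the first `k` rows fixed, the right inverse is constant and `M R` depends only on the
remaining rows. Each entry of the product is then a linear form in independent Gaussians, with
second moment the sum of its squared coefficients. -/
theorem lintegral_frobSq_mul_topRowsInv_le {m n r k : ℕ} (hk : k ≤ n)
    {M : Matrix (Fin m) (Fin n) ℝ} (hM : ∀ i l, l.1 < k → M i l = 0) :
    ∫⁻ R, ENNReal.ofReal (frobSq (M * Matrix.of R * topRowsInv hk R))
        ∂gaussianMatrixLaw n r
      ≤ ∫⁻ R, ENNReal.ofReal (frobSq M * frobSq (topRowsInv hk R)) ∂gaussianMatrixLaw n r := by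
  let s : Finset (Fin n) := Finset.univ.filter fun l => k ≤ l.1
  have hs : ∀ l : Fin n, l ∉ s → l.1 < k := fun l hl => by simpa [s] using hl
  refine lintegral_le_of_lmarginal_le s
    (measurable_frobSq_mul_topRowsInv hk M).ennreal_ofReal
    ((measurable_frobSq fun a j => measurable_topRowsInv_apply hk a j).const_mul _).ennreal_ofReal ?_
  intro x
  simp only [lmarginal]
  have hinv : ∀ y, topRowsInv hk (Function.updateFinset x s y) = topRowsInv hk x := by
    intro y
    have : topRows hk (Function.updateFinset x s y) = topRows hk x := by
      ext l a
      have : Fin.castLE hk l ∉ s := by simp [s]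
      simp only [topRows, Matrix.of_apply, Function.updateFinset, dif_neg this]
    rw [topRowsInv, topRowsInv, this]
  simp only [hinv, lintegral_const, measure_univ, mul_one]
  set H := topRowsInv hk x
  have hprod : ∀ (y : ∀ _ : s, Fin r → ℝ) i j,
      (M * Matrix.of (Function.updateFinset x s y) * H) i j
        = ∑ l : s, ∑ a, M i l * H a j * y l a := by
    intro y i j
    rw [Matrix.mul_apply, Finset.sum_comm]
    refine Finset.sum_congr rfl fun a _ => ?_
    rw [Matrix.mul_apply, Finset.sum_mul]
    rw [← Finset.sum_subset (Finset.subset_univ s) fun l _ hl => by rw [hM i l (hs l hl)]; simp]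
    rw [← Finset.sum_coe_sort s]
    refine Finset.sum_congr rfl fun l _ => ?_
    have : Matrix.of (Function.updateFinset x s y) (l : Fin n) a = y l a := by
      simp [Function.updateFinset]
    rw [this]
    ring
  have hmeas : ∀ i j, Measurable fun y : ∀ _ : s, Fin r → ℝ =>
      ENNReal.ofReal ((∑ l : s, ∑ a, M i l * H a j * y l a) ^ 2) := by
    intro i j
    fun_prop
  have hsum : ∀ y : ∀ _ : s, Fin r → ℝ,
      ENNReal.ofReal (frobSq (M * Matrix.of (Function.updateFinset x s y) * H))
        = ∑ i, ∑ j, ENNReal.ofReal ((∑ l : s, ∑ a, M i l * H a j * y l a) ^ 2) := by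
    intro y
    simp only [frobSq, hprod]
    rw [ENNReal.ofReal_sum_of_nonneg fun i _ => Finset.sum_nonneg fun j _ => sq_nonneg _]
    refine Finset.sum_congr rfl fun i _ => ?_
    rw [ENNReal.ofReal_sum_of_nonneg fun j _ => sq_nonneg _]
  simp only [hsum]
  rw [lintegral_finsetSum _ fun i _ => Finset.measurable_sum _ fun j _ => hmeas i j]
  simp only [lintegral_finsetSum _ fun j (_ : j ∈ Finset.univ) => hmeas _ j,
    lintegral_sq_sum_gaussian]
  simp only [← ENNReal.ofReal_sum_of_nonneg fun j (_ : j ∈ (Finset.univ : Finset (Fin k))) =>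
    Finset.sum_nonneg fun (l : s) _ => Finset.sum_nonneg fun a _ => sq_nonneg (M _ l * H a j)]
  rw [← ENNReal.ofReal_sum_of_nonneg fun i _ => Finset.sum_nonneg fun j _ =>
    Finset.sum_nonneg fun (l : s) _ => Finset.sum_nonneg fun a _ => sq_nonneg (M i l * H a j)]
  refine ENNReal.ofReal_le_ofReal ?_
  rw [frobSq, Finset.sum_mul]
  refine Finset.sum_le_sum fun i _ => ?_
  rw [← frobSq_transpose H, frobSq, Finset.mul_sum]
  refine Finset.sum_le_sum fun j _ => ?_
  rw [Finset.sum_mul_sum, Finset.sum_coe_sort s fun l => ∑ a, (M i l * H a j) ^ 2]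
  refine (Finset.sum_le_sum_of_subset_of_nonneg (Finset.subset_univ s) fun l _ _ =>
    Finset.sum_nonneg fun a _ => sq_nonneg _).trans_eq ?_
  simp [mul_pow]

/-- The sketching error is at most the optimal error, up to a factor `1 + ε`, with probability at
least `0.99`. -/
theorem gaussianMatrixLaw_good_sketch {m n r k : ℕ} (hk0 : 0 < k) (hk : k ≤ n) {ε : ℝ}
    (hε : 0 < ε) (hr : 100 * k / ε + k + 1 ≤ r) {M : Matrix (Fin m) (Fin n) ℝ}
    (hM : ∀ i l, l.1 < k → M i l = 0) :
    MeasurableSet {R : Fin n → Fin r → ℝ | (topRows hk R * (topRows hk R).transpose).det ≠ 0 ∧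
        frobSq (M * Matrix.of R * topRowsInv hk R) ≤ ε * frobSq M} ∧
      ENNReal.ofReal 0.99 ≤ gaussianMatrixLaw n r
        {R | (topRows hk R * (topRows hk R).transpose).det ≠ 0 ∧
          frobSq (M * Matrix.of R * topRowsInv hk R) ≤ ε * frobSq M} := by
  have hkpos : (0 : ℝ) < k := by exact_mod_cast hk0
  have hpos : 0 < 100 * k / ε := by positivity
  have hr' : k + 2 ≤ r := by
    have : ((k + 1 : ℕ) : ℝ) < r := by push_cast; linarith
    exact_mod_cast this
  have hmeas : MeasurableSet {R : Fin n → Fin r → ℝ |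
      (topRows hk R * (topRows hk R).transpose).det ≠ 0 ∧
        frobSq (M * Matrix.of R * topRowsInv hk R) ≤ ε * frobSq M} := by
    refine MeasurableSet.inter ?_ ?_
    · exact (measurableSet_eq_fun (continuous_gram_topRows hk).matrix_det.measurable
        measurable_const).compl
    · exact measurableSet_le (measurable_frobSq_mul_topRowsInv hk M) measurable_const
  refine ⟨hmeas, ?_⟩
  have hbad : gaussianMatrixLaw n r {R | ε * frobSq M < frobSq (M * Matrix.of R * topRowsInv hk R)}
      ≤ ENNReal.ofReal 0.01 := by
    -- Markov's inequality divides by `ε * frobSq M`, so `M = 0` is separate.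
    rcases (frobSq_nonneg M).eq_or_lt with h0 | h0
    · have hM0 : M = 0 := by
        ext i j
        have h1 := (Finset.sum_eq_zero_iff_of_nonneg fun i _ =>
          Finset.sum_nonneg fun j _ => sq_nonneg _).1 h0.symm i (Finset.mem_univ _)
        have h2 := (Finset.sum_eq_zero_iff_of_nonneg fun j _ => sq_nonneg _).1 h1 j
          (Finset.mem_univ _)
        exact pow_eq_zero_iff two_ne_zero |>.1 h2
      subst hM0
      simp [frobSq]
    have hexp : ∫⁻ R, ENNReal.ofReal (frobSq (M * Matrix.of R * topRowsInv hk R))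
        ∂gaussianMatrixLaw n r ≤ ENNReal.ofReal (ε * frobSq M) * ENNReal.ofReal 0.01 := by
      refine (lintegral_frobSq_mul_topRowsInv_le hk hM).trans ?_
      have e : ∀ R : Fin n → Fin r → ℝ, ENNReal.ofReal (frobSq M * frobSq (topRowsInv hk R))
          ≤ ENNReal.ofReal (frobSq M) * ∑ j, ENNReal.ofReal ((topRows hk R
            * (topRows hk R).transpose + (0 : ℝ) • (1 : Matrix (Fin k) (Fin k) ℝ))⁻¹ j j) := by
        intro R
        rw [ENNReal.ofReal_mul h0.le, topRowsInv, frobSq_right_inverse, zero_smul, add_zero]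
        gcongr
        exact Finset.le_sum_of_subadditive _ ENNReal.ofReal_zero.le
          (fun _ _ => ENNReal.ofReal_add_le) _ _
      refine (lintegral_mono e).trans ?_
      rw [lintegral_const_mul' _ _ ENNReal.ofReal_ne_top, mul_comm ε, ENNReal.ofReal_mul h0.le,
        mul_assoc]
      gcongr
      refine (lintegral_trace_gram_inv_le hk hr' le_rfl).trans ?_
      rw [← ENNReal.ofReal_mul hε.le]
      refine ENNReal.ofReal_le_ofReal ?_
      have h1 : 100 * k / ε ≤ (r : ℝ) - k - 1 := by linarith
      -- This is where the factor `100` in the sketch size is used.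
      calc (k : ℝ) / ((r : ℝ) - k - 1) ≤ k / (100 * k / ε) := by gcongr
        _ = ε * 0.01 := by field_simp; norm_num
    have hpos' : 0 < ε * frobSq M := mul_pos hε h0
    have hmarkov := (mul_meas_ge_le_lintegral₀
      (measurable_frobSq_mul_topRowsInv hk M).ennreal_ofReal.aemeasurable
      (ENNReal.ofReal (ε * frobSq M))).trans hexp
    refine le_trans (measure_mono fun R hR => ?_) ((ENNReal.mul_le_mul_iff_right
      (ENNReal.ofReal_pos.2 hpos').ne' ENNReal.ofReal_ne_top).1 hmarkov)
    exact ENNReal.ofReal_le_ofReal (le_of_lt hR)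
  have hcompl : gaussianMatrixLaw n r {R : Fin n → Fin r → ℝ |
      (topRows hk R * (topRows hk R).transpose).det ≠ 0 ∧
        frobSq (M * Matrix.of R * topRowsInv hk R) ≤ ε * frobSq M}ᶜ ≤ ENNReal.ofReal 0.01 := by
    refine le_trans (measure_mono (t := {R | (topRows hk R * (topRows hk R).transpose).det = 0} ∪
      {R | ε * frobSq M < frobSq (M * Matrix.of R * topRowsInv hk R)}) fun R hR => ?_) ?_
    · by_cases h : (topRows hk R * (topRows hk R).transpose).det = 0
      · exact Or.inl h
      · exact Or.inr (not_le.1 fun h' => hR ⟨h, h'⟩)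
    · refine (measure_union_le _ _).trans ?_
      rw [gaussianMatrixLaw_det_gram_eq_zero hk hr', zero_add]
      exact hbad
  have h1 := prob_compl_eq_one_sub (μ := gaussianMatrixLaw n r) hmeas.compl
  rw [compl_compl] at h1
  rw [h1]
  refine le_trans (le_of_eq ?_) (tsub_le_tsub_left hcompl 1)
  rw [← ENNReal.ofReal_one, ← ENNReal.ofReal_sub _ (by norm_num)]
  norm_num

/-! ### Reasoning about programs -/

namespace RealProg

theorem exec_bind {α β : Type} (svd : SVDRoutine) (κ : ℕ) (p : RealProg ℝ α)
    (f : α → RealProg ℝ β) (ω : ℕ → ℝ) :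
    exec svd κ (p >>= f) ω = (exec svd κ (f (exec svd κ p ω).value) (exec svd κ p ω).tape).tick
      (exec svd κ p ω).steps := by
  change exec svd κ (bind p f) ω = _
  induction p generalizing ω with
  | ret a => simp [bind, exec, Outcome.tick]
  | zero g ih => simp [bind, exec, ih, Outcome.tick, add_assoc]
  | add x y g ih => simp [bind, exec, ih, Outcome.tick, add_assoc]
  | sub x y g ih => simp [bind, exec, ih, Outcome.tick, add_assoc]
  | mul x y g ih => simp [bind, exec, ih, Outcome.tick, add_assoc]
  | div x y g ih => simp [bind, exec, ih, Outcome.tick, add_assoc]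
  | sqrt x g ih => simp [bind, exec, ih, Outcome.tick, add_assoc]
  | isZero x g ih => simp [bind, exec, ih, Outcome.tick, add_assoc]
  | gauss g ih => simp [bind, exec, ih, Outcome.tick, add_assoc]
  | topSV k hk B g ih => simp [bind, exec, ih, Outcome.tick, add_assoc]

/-- Executed on the tape `ω`, the program takes at most `c` steps, and its result and the unread
part of the tape satisfy `P`. -/
def Satisfies {α : Type} (svd : SVDRoutine) (κ : ℕ) (p : RealProg ℝ α) (ω : ℕ → ℝ) (c : ℕ)
    (P : α → (ℕ → ℝ) → Prop) : Prop :=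
  (exec svd κ p ω).steps ≤ c ∧ P (exec svd κ p ω).value (exec svd κ p ω).tape

variable {svd : SVDRoutine} {κ : ℕ}

theorem Satisfies.mono {α : Type} {p : RealProg ℝ α} {ω : ℕ → ℝ} {c c' : ℕ}
    {P P' : α → (ℕ → ℝ) → Prop} (h : Satisfies svd κ p ω c P) (hc : c ≤ c')
    (hP : ∀ a τ, P a τ → P' a τ) : Satisfies svd κ p ω c' P' :=
  ⟨h.1.trans hc, hP _ _ h.2⟩

theorem Satisfies.bind {α β : Type} {p : RealProg ℝ α} {f : α → RealProg ℝ β} {ω : ℕ → ℝ}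
    {c c' : ℕ} {P : α → (ℕ → ℝ) → Prop} {P' : β → (ℕ → ℝ) → Prop}
    (h : Satisfies svd κ p ω c P) (h' : ∀ a τ, P a τ → Satisfies svd κ (f a) τ c' P') :
    Satisfies svd κ (p >>= f) ω (c + c') P' := by
  have := h' _ _ h.2
  rw [Satisfies, exec_bind]
  exact ⟨by rw [add_comm c]; exact add_le_add this.1 h.1, this.2⟩

theorem Satisfies.pure {α : Type} {a : α} {ω : ℕ → ℝ} {P : α → (ℕ → ℝ) → Prop} (h : P a ω) :
    Satisfies svd κ (Pure.pure a) ω 0 P :=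
  ⟨le_rfl, h⟩

theorem satisfies_zero (ω : ℕ → ℝ) :
    Satisfies svd κ (zero ret) ω 1 fun a _ => a = 0 := ⟨le_rfl, rfl⟩

theorem satisfies_add (x y : ℝ) (ω : ℕ → ℝ) :
    Satisfies svd κ (add x y ret) ω 1 fun a _ => a = x + y := ⟨le_rfl, rfl⟩

theorem satisfies_sub (x y : ℝ) (ω : ℕ → ℝ) :
    Satisfies svd κ (sub x y ret) ω 1 fun a _ => a = x - y := ⟨le_rfl, rfl⟩

theorem satisfies_mul (x y : ℝ) (ω : ℕ → ℝ) :
    Satisfies svd κ (mul x y ret) ω 1 fun a _ => a = x * y := ⟨le_rfl, rfl⟩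

theorem satisfies_div (x y : ℝ) (ω : ℕ → ℝ) :
    Satisfies svd κ (div x y ret) ω 1 fun a _ => a = x / y := ⟨le_rfl, rfl⟩

theorem satisfies_sqrt (x : ℝ) (ω : ℕ → ℝ) :
    Satisfies svd κ (sqrt x ret) ω 1 fun a _ => a = Real.sqrt x := ⟨le_rfl, rfl⟩

theorem satisfies_isZero (x : ℝ) (ω : ℕ → ℝ) :
    Satisfies svd κ (isZero x ret) ω 1 fun a _ => (a = true ↔ x = 0) :=
  ⟨le_rfl, by simp [exec, Outcome.tick]⟩

theorem satisfies_gauss (ω : ℕ → ℝ) :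
    Satisfies svd κ (gauss ret) ω 1 fun a τ => a = ω 0 ∧ τ = fun x => ω (x + 1) :=
  ⟨le_rfl, rfl, rfl⟩

theorem satisfies_topSV {p q k : ℕ} (hk : k ≤ q) (B : Matrix (Fin p) (Fin q) ℝ) (ω : ℕ → ℝ) :
    Satisfies svd κ (topSV k hk B ret) ω (κ * (p * q * min p q + q * k ^ 2))
      fun Z _ => IsTopRightSingularVectors hk B Z :=
  ⟨by simp [exec, Outcome.tick], svd.isTop _ _ _ _ _⟩

/-- Every iteration consumes exactly `s` tape cells, so iteration `i` starts at cell `i * s`; nested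
loops thus read a matrix row by row. -/
theorem satisfies_forFin_tape {β : Type} {n : ℕ} {f : Fin n → RealProg ℝ β} {c s : ℕ}
    {g : Fin n → (ℕ → ℝ) → β} (ω : ℕ → ℝ)
    (h : ∀ i τ, Satisfies svd κ (f i) τ c fun a τ' => a = g i τ ∧ τ' = fun x => τ (x + s)) :
    Satisfies svd κ (forFin n f) ω (n * c) fun a τ =>
      a = (fun i => g i fun x => ω (x + i * s)) ∧ τ = fun x => ω (x + n * s) := by
  induction n generalizing ω with
  | zero => exact ⟨by simp [forFin, Pure.pure, exec], by ext i; exact i.elim0, by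
      simp [forFin, Pure.pure, exec]⟩
  | succ n ih =>
    refine Satisfies.mono ((h 0 ω).bind fun a τ ha => (ih τ fun i => h i.succ).bind
      (P' := fun a τ => a = (fun i => g i fun x => ω (x + i * s)) ∧
        τ = fun x => ω (x + (n + 1) * s)) (c' := 0)
      fun as τ' has => Satisfies.pure ?_) (by rw [Nat.succ_mul]; omega) fun _ _ h => h
    obtain ⟨rfl, rfl⟩ := ha
    obtain ⟨rfl, rfl⟩ := has
    refine ⟨?_, ?_⟩
    · ext i
      refine Fin.cases ?_ (fun i => ?_) i
      · simp
      · simp only [Fin.cons_succ, Fin.val_succ]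
        congr 1
        ext x
        congr 1
        ring
    · ext x
      change ω (x + n * s + s) = ω (x + (n + 1) * s)
      congr 1
      ring

theorem satisfies_forFin {β : Type} {n : ℕ} {f : Fin n → RealProg ℝ β} {c : ℕ}
    {g : Fin n → β} (ω : ℕ → ℝ) (h : ∀ i τ, Satisfies svd κ (f i) τ c fun a _ => a = g i) :
    Satisfies svd κ (forFin n f) ω (n * c) fun a _ => a = g := by
  induction n generalizing ω with
  | zero => exact ⟨by simp [forFin, Pure.pure, exec], by ext i; exact i.elim0⟩
  | succ n ih =>
    refine Satisfies.mono ((h 0 ω).bind fun a τ ha => (ih τ fun i => h i.succ).bind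
      (P' := fun a _ => a = g) (c' := 0)
      fun as τ' has => Satisfies.pure ?_) (by rw [Nat.succ_mul]; omega) fun _ _ h => h
    subst ha has
    ext i
    refine Fin.cases ?_ (fun i => ?_) i <;> simp

theorem satisfies_dot (n : ℕ) (x y : Fin n → ℝ) (ω : ℕ → ℝ) :
    Satisfies svd κ (dot n x y) ω (2 * n + 1) fun a _ => a = x ⬝ᵥ y := by
  induction n generalizing ω with
  | zero => exact (satisfies_zero ω).mono (by omega) fun a _ h => by simp [h]
  | succ n ih =>
    refine Satisfies.mono (P := fun a _ => a = x ⬝ᵥ y)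
      ((ih (fun i => x i.succ) (fun i => y i.succ) ω).bind fun a τ ha =>
        (satisfies_mul (x 0) (y 0) τ).bind fun b τ' hb =>
          (satisfies_add b a τ').mono le_rfl fun v _ hv => ?_) (by omega) fun _ _ h => h
    rw [hv, hb, ha, dotProduct, dotProduct, Fin.sum_univ_succ]

theorem satisfies_matMul {p q r : ℕ} (A : Matrix (Fin p) (Fin q) ℝ) (B : Matrix (Fin q) (Fin r) ℝ)
    (ω : ℕ → ℝ) :
    Satisfies svd κ (matMul A B) ω (p * (r * (2 * q + 1))) fun C _ => C = A * B :=
  satisfies_forFin (g := fun i j => (A * B) i j) ω fun _ τ =>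
    satisfies_forFin τ fun _ τ' => satisfies_dot q _ _ τ'

theorem satisfies_gaussianMatrix (n r : ℕ) (ω : ℕ → ℝ) :
    Satisfies svd κ (gaussianMatrix n r) ω (n * (r * 1)) fun R _ =>
      R = Matrix.of fun i j => ω (j.1 + i.1 * r) := by
  refine (satisfies_forFin_tape (s := r) (g := fun _ τ (j : Fin r) => τ j.1) ω
    fun i τ => ?_).mono le_rfl fun R _ h => h.1
  refine (satisfies_forFin_tape (s := 1) (g := fun _ τ => τ 0) τ fun j τ' =>
    satisfies_gauss τ').mono le_rfl fun R τ' h => ?_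
  simpa using h

end RealProg

/-! ### The Gram–Schmidt process -/

/-- The vectors of the list form an orthonormal system. -/
def OrthonormalList {m : ℕ} (Q : List (Fin m → ℝ)) : Prop :=
  Q.Pairwise (fun u v => u ⬝ᵥ v = 0) ∧ ∀ u ∈ Q, u ⬝ᵥ u = 1

/-- The fold takes each coefficient from the current remainder, not from the original vector,
exactly as `removeComponents` does. -/
theorem foldl_sub_mem_span {m : ℕ} (Q : List (Fin m → ℝ)) (v : Fin m → ℝ) :
    v - Q.foldl (fun v u => v - (u ⬝ᵥ v) • u) v ∈ Submodule.span ℝ {u | u ∈ Q} := by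
  induction Q generalizing v with
  | nil => simp
  | cons u Q ih =>
    have h1 := Submodule.span_mono (R := ℝ) (s := {w | w ∈ Q}) (t := {w | w ∈ u :: Q})
      (fun w hw => List.mem_cons_of_mem _ hw) (ih (v - (u ⬝ᵥ v) • u))
    have h2 : (u ⬝ᵥ v) • u ∈ Submodule.span ℝ {w | w ∈ u :: Q} :=
      Submodule.smul_mem _ _ (Submodule.subset_span List.mem_cons_self)
    have := Submodule.add_mem _ h1 h2
    rw [List.foldl_cons]
    convert this using 1
    abel

theorem dotProduct_foldl_sub {m : ℕ} {Q : List (Fin m → ℝ)} {x : Fin m → ℝ}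
    (hx : ∀ u ∈ Q, x ⬝ᵥ u = 0) (v : Fin m → ℝ) :
    x ⬝ᵥ Q.foldl (fun v u => v - (u ⬝ᵥ v) • u) v = x ⬝ᵥ v := by
  induction Q generalizing v with
  | nil => rfl
  | cons u Q ih =>
    rw [List.foldl_cons, ih fun w hw => hx w (List.mem_cons_of_mem _ hw), dotProduct_sub,
      dotProduct_smul, hx u List.mem_cons_self, smul_zero, sub_zero]

/-- Once the component along `u` is removed, later subtractions are along vectors orthogonal to `u`
and cannot bring it back. -/
theorem OrthonormalList.dotProduct_foldl_sub {m : ℕ} {Q : List (Fin m → ℝ)}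
    (hQ : OrthonormalList Q) (v : Fin m → ℝ) :
    ∀ x ∈ Q, x ⬝ᵥ Q.foldl (fun v u => v - (u ⬝ᵥ v) • u) v = 0 := by
  induction Q generalizing v with
  | nil => simp
  | cons u Q ih =>
    obtain ⟨h1, h2⟩ := hQ
    rw [List.pairwise_cons] at h1
    intro x hx
    rw [List.foldl_cons]
    rcases List.mem_cons.1 hx with rfl | hx
    · rw [_root_.dotProduct_foldl_sub h1.1, dotProduct_sub, dotProduct_smul,
        h2 x List.mem_cons_self]
      simp
    · exact ih ⟨h1.2, fun w hw => h2 w (List.mem_cons_of_mem _ hw)⟩ _ x hx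

theorem OrthonormalList.append_normalized {m : ℕ} {Q : List (Fin m → ℝ)} (hQ : OrthonormalList Q)
    {v : Fin m → ℝ} (hv : ∀ x ∈ Q, x ⬝ᵥ v = 0) (hv0 : v ⬝ᵥ v ≠ 0) :
    OrthonormalList (Q ++ [fun i => v i / Real.sqrt (v ⬝ᵥ v)]) := by
  have hpos : 0 < v ⬝ᵥ v :=
    lt_of_le_of_ne (Finset.sum_nonneg fun i _ => mul_self_nonneg _) hv0.symm
  have e : (fun i => v i / Real.sqrt (v ⬝ᵥ v)) = (Real.sqrt (v ⬝ᵥ v))⁻¹ • v := by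
    ext i; simp [div_eq_inv_mul]
  rw [e]
  refine ⟨?_, ?_⟩
  · rw [List.pairwise_append]
    refine ⟨hQ.1, List.pairwise_singleton _ _, fun x hx w hw => ?_⟩
    rw [List.mem_singleton.1 hw, dotProduct_smul, hv x hx, smul_zero]
  · intro u hu
    rcases List.mem_append.1 hu with hu | hu
    · exact hQ.2 u hu
    · rw [List.mem_singleton.1 hu, dotProduct_smul, smul_dotProduct, smul_eq_mul, smul_eq_mul,
        ← mul_assoc, ← mul_inv, Real.mul_self_sqrt hpos.le, inv_mul_cancel₀ hv0]

/-- The matrix whose rows are the vectors of a list. -/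
def listRows {m : ℕ} (Q : List (Fin m → ℝ)) : Matrix (Fin Q.length) (Fin m) ℝ :=
  Matrix.of fun a i => Q.get a i

theorem OrthonormalList.listRows_mul_transpose {m : ℕ} {Q : List (Fin m → ℝ)}
    (hQ : OrthonormalList Q) : listRows Q * (listRows Q).transpose = 1 := by
  ext a b
  have e : (listRows Q * (listRows Q).transpose) a b = Q.get a ⬝ᵥ Q.get b := rfl
  rw [e, Matrix.one_apply]
  split_ifs with h
  · subst h; exact hQ.2 _ (List.get_mem _ _)
  · rcases lt_or_gt_of_ne h with h | h
    · exact List.pairwise_iff_get.1 hQ.1 a b h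
    · rw [dotProduct_comm]; exact List.pairwise_iff_get.1 hQ.1 b a h

theorem OrthonormalList.transpose_mulVec_mulVec {m : ℕ} {Q : List (Fin m → ℝ)}
    (hQ : OrthonormalList Q) {y : Fin m → ℝ} (hy : y ∈ Submodule.span ℝ {u | u ∈ Q}) :
    (listRows Q).transpose.mulVec ((listRows Q).mulVec y) = y := by
  induction hy using Submodule.span_induction with
  | mem u hu =>
    obtain ⟨a, rfl⟩ := List.get_of_mem hu
    have e : Q.get a = (listRows Q).transpose.mulVec (Pi.single a 1) := by
      rw [Matrix.mulVec_single_one]; rfl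
    rw [e, Matrix.mulVec_mulVec _ (listRows Q), hQ.listRows_mul_transpose, Matrix.one_mulVec]
  | zero => simp
  | add x y _ _ hx hy => rw [Matrix.mulVec_add, Matrix.mulVec_add, hx, hy]
  | smul c x _ hx => rw [Matrix.mulVec_smul, Matrix.mulVec_smul, hx]

/-- An orthonormal system in the column space of `A` is not larger than `A`. -/
theorem OrthonormalList.length_le {m n : ℕ} {Q : List (Fin m → ℝ)} (hQ : OrthonormalList Q)
    {A : Matrix (Fin m) (Fin n) ℝ} (hA : ∀ u ∈ Q, u ∈ LinearMap.range A.mulVecLin) :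
    Q.length ≤ min m n := by
  choose f hf using hA
  let W : Matrix (Fin n) (Fin Q.length) ℝ := Matrix.of fun i a => f (Q.get a) (List.get_mem _ _) i
  have hW : A * W = (listRows Q).transpose := by
    ext i a
    exact congrFun (hf (Q.get a) (List.get_mem _ _)) i
  -- The identity of size `Q.length` factors through spaces of dimensions `m` and `n`, so its rank
  -- is at most either.
  have h1 : (listRows Q * A * W).rank = Q.length := by
    rw [Matrix.mul_assoc, hW, hQ.listRows_mul_transpose, Matrix.rank_one, Fintype.card_fin]
  refine le_min ?_ ?_
  · rw [← h1, Matrix.mul_assoc]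
    exact (Matrix.rank_mul_le_left _ _).trans (by simpa using Matrix.rank_le_card_width (listRows Q))
  · rw [← h1]
    exact (Matrix.rank_mul_le_right _ _).trans (by simpa using Matrix.rank_le_card_height W)

/-! ### Correctness and cost of Gram–Schmidt and feature extraction -/

namespace RealProg

variable {svd : SVDRoutine} {κ : ℕ}

theorem satisfies_removeComponents {m : ℕ} (Q : List (Fin m → ℝ)) (v : Fin m → ℝ) (ω : ℕ → ℝ) :
    Satisfies svd κ (removeComponents Q v) ω (Q.length * (4 * m + 1)) fun w _ =>
      w = Q.foldl (fun v u => v - (u ⬝ᵥ v) • u) v := by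
  induction Q generalizing v ω with
  | nil => exact Satisfies.mono (Satisfies.pure rfl) (by simp) fun _ _ h => h
  | cons u Q ih =>
    refine Satisfies.mono (P := fun w _ => w = Q.foldl (fun v u => v - (u ⬝ᵥ v) • u)
        (v - (u ⬝ᵥ v) • u))
      ((satisfies_dot m u v ω).bind fun c τ hc =>
        (satisfies_forFin (g := v - (u ⬝ᵥ v) • u) (c := 1 + 1) τ fun i τ' =>
          (satisfies_mul c (u i) τ').bind fun t τ'' ht =>
            (satisfies_sub (v i) t τ'').mono le_rfl fun w _ hw => ?_).bind
              (c' := Q.length * (4 * m + 1)) fun w τ' hw => ?_)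
      ?_ fun _ _ h => h
    · rw [hw, ht, hc]; rfl
    · rw [hw]; exact ih _ _
    · rw [List.length_cons, add_one_mul]; omega

/-- Membership in the column space of `A` is kept as an invariant for the sake of the cost: it caps
the list at `min m n` vectors, so one new vector costs at most `min m n` component removals, a
squared norm, `m` divisions, a zero test and a square root. -/
theorem satisfies_gramSchmidt {m n : ℕ} {A : Matrix (Fin m) (Fin n) ℝ} (Q ys : List (Fin m → ℝ))
    (hQ : OrthonormalList Q) (hQA : ∀ u ∈ Q, u ∈ LinearMap.range A.mulVecLin)
    (hys : ∀ y ∈ ys, y ∈ LinearMap.range A.mulVecLin) (ω : ℕ → ℝ) :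
    Satisfies svd κ (gramSchmidt Q ys) ω
      (ys.length * (min m n * (4 * m + 1) + (2 * m + 1) + m + 2)) fun Q' _ =>
        OrthonormalList Q' ∧ (∀ u ∈ Q', u ∈ LinearMap.range A.mulVecLin) ∧ (∀ u ∈ Q, u ∈ Q') ∧
        Q'.length ≤ Q.length + ys.length ∧ ∀ y ∈ ys, y ∈ Submodule.span ℝ {u | u ∈ Q'} := by
  induction ys generalizing Q ω with
  | nil => exact ⟨Nat.zero_le _, hQ, hQA, fun _ h => h, le_rfl, by simp⟩
  | cons y ys ih =>
    have hlen := hQ.length_le hQA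
    set v := Q.foldl (fun v u => v - (u ⬝ᵥ v) • u) y with hv
    have hvspan := foldl_sub_mem_span Q y
    rw [← hv] at hvspan
    have horth := hQ.dotProduct_foldl_sub y
    rw [← hv] at horth
    have hsub : Submodule.span ℝ {u | u ∈ Q} ≤ LinearMap.range A.mulVecLin :=
      Submodule.span_le.2 hQA
    have hvA : v ∈ LinearMap.range A.mulVecLin := by
      have := Submodule.sub_mem _ (hys y List.mem_cons_self) (hsub hvspan)
      rwa [sub_sub_cancel] at this
    have hys' : ∀ z ∈ ys, z ∈ LinearMap.range A.mulVecLin := fun z hz =>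
      hys z (List.mem_cons_of_mem _ hz)
    refine Satisfies.mono (c := Q.length * (4 * m + 1) + ((2 * m + 1) + (1 + (1 + (m * 1
        + ys.length * (min m n * (4 * m + 1) + (2 * m + 1) + m + 2))))))
      ((satisfies_removeComponents Q y ω).bind fun w τ hw =>
        (satisfies_dot m w w τ).bind fun s τ' hs => (satisfies_isZero s τ').bind fun z τ'' hz => ?_)
      ?_ fun _ _ h => h
    · rw [← hv] at hw
      subst hw hs
      rcases Bool.eq_false_or_eq_true z with rfl | rfl
      -- A zero remainder means that `y` already lies in the span of `Q`, so it can be skipped.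
      · have hv0 : v = 0 := dotProduct_self_eq_zero.1 (hz.1 rfl)
        refine (ih Q hQ hQA hys' τ'').mono (by omega) ?_
        rintro Q' - ⟨h1, h2, h3, h4, h5⟩
        refine ⟨h1, h2, h3, by rw [List.length_cons]; omega, fun x hx => ?_⟩
        rcases List.mem_cons.1 hx with rfl | hx
        · rw [hv0, sub_zero] at hvspan
          exact Submodule.span_mono h3 hvspan
        · exact h5 x hx
      · have hv0 : v ⬝ᵥ v ≠ 0 := fun h => by simpa using hz.2 h
        refine (satisfies_sqrt _ τ'').bind fun t τ₁ ht =>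
          (satisfies_forFin (g := fun i => v i / t) τ₁ fun i τ₂ =>
            satisfies_div (v i) t τ₂).bind fun u τ₂ hu => ?_
        subst hu ht
        set u : Fin m → ℝ := fun i => v i / Real.sqrt (v ⬝ᵥ v) with hu
        have hvu : v = Real.sqrt (v ⬝ᵥ v) • u := by
          have : Real.sqrt (v ⬝ᵥ v) ≠ 0 := (Real.sqrt_pos.2 (lt_of_le_of_ne
            (Finset.sum_nonneg fun i _ => mul_self_nonneg _) hv0.symm)).ne'
          ext i
          simp only [hu, Pi.smul_apply, smul_eq_mul]
          field_simp
        have huA : u ∈ LinearMap.range A.mulVecLin := by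
          have e : u = (Real.sqrt (v ⬝ᵥ v))⁻¹ • v := by
            ext i; simp [hu, div_eq_inv_mul]
          rw [e]
          exact Submodule.smul_mem _ _ hvA
        refine (ih (Q ++ [u]) (hQ.append_normalized horth hv0) ?_ hys' τ₂).mono le_rfl ?_
        · intro x hx
          rcases List.mem_append.1 hx with hx | hx
          · exact hQA x hx
          · rw [List.mem_singleton.1 hx]; exact huA
        rintro Q' - ⟨h1, h2, h3, h4, h5⟩
        refine ⟨h1, h2, fun x hx => h3 x (List.mem_append_left _ hx), ?_, fun x hx => ?_⟩
        · rw [List.length_append, List.length_singleton] at h4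
          rw [List.length_cons]; omega
        rcases List.mem_cons.1 hx with rfl | hx
        · have a1 := Submodule.span_mono (R := ℝ) (s := {w | w ∈ Q}) (t := {w | w ∈ Q'})
            (fun w hw => h3 w (List.mem_append_left _ hw)) hvspan
          have a2 : v ∈ Submodule.span ℝ {w | w ∈ Q'} := by
            rw [hvu]
            exact Submodule.smul_mem _ _ (Submodule.subset_span
              (h3 u (List.mem_append_right _ (List.mem_singleton_self _))))
          have := Submodule.add_mem _ a1 a2
          rwa [sub_add_cancel] at this
        · exact h5 x hx
    · have := Nat.mul_le_mul_right (4 * m + 1) hlen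
      rw [List.length_cons, add_one_mul]
      omega

/-- What the feature extraction computes, and its running time. -/
theorem satisfies_featureExtraction {m n k : ℕ} (A : Matrix (Fin m) (Fin n) ℝ) (hk1 : 1 ≤ k) (hkm : k ≤ m)
    (hk : k ≤ n) (ε : ℝ) (ω : ℕ → ℝ) :
    Satisfies svd κ (featureExtraction A k hk ε) ω
      ((24 + 2 * κ) * (sketchSize k ε * m * n)) fun C _ =>
        ∃ (q : ℕ) (Q : Matrix (Fin m) (Fin q) ℝ) (T : Matrix (Fin q) (Fin (sketchSize k ε)) ℝ)
          (Z : Matrix (Fin n) (Fin k) ℝ), Q.transpose * Q = 1 ∧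
          Q * T = A * Matrix.of (fun i j => ω (j.1 + i.1 * sketchSize k ε)) ∧
          IsTopRightSingularVectors hk (Q.transpose * A) Z ∧ C = A * Z := by
  set r := sketchSize k ε with hr
  have hkr : k ≤ r := Nat.le_add_right _ _
  set R : Matrix (Fin n) (Fin r) ℝ := Matrix.of fun i j => ω (j.1 + i.1 * r) with hR
  have hZ : Satisfies svd κ (fastFrobeniusSVD A k hk ε) ω
      (n * (r * 1) + (m * (r * (2 * n + 1)) + (r * (min m n * (4 * m + 1) + (2 * m + 1) + m + 2)
        + (r * (n * (2 * m + 1)) + κ * (r * n * m + n * k ^ 2))))) fun Z _ =>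
        ∃ (q : ℕ) (Q : Matrix (Fin m) (Fin q) ℝ) (T : Matrix (Fin q) (Fin r) ℝ),
          Q.transpose * Q = 1 ∧ Q * T = A * R ∧
          IsTopRightSingularVectors hk (Q.transpose * A) Z := by
    refine (satisfies_gaussianMatrix n r ω).bind fun R' τ hR' =>
      (satisfies_matMul A R' τ).bind fun Y τ' hY => ?_
    rw [← hR] at hR'
    subst hR' hY
    have hcol : ∀ y ∈ (List.ofFn fun j => fun i => (A * R) i j),
        y ∈ LinearMap.range A.mulVecLin := by
      intro y hy
      obtain ⟨j, rfl⟩ := (List.mem_ofFn' _ _).1 hy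
      exact ⟨fun l => R l j, rfl⟩
    have hgs := satisfies_gramSchmidt (svd := svd) (κ := κ) (A := A) []
      (List.ofFn fun j => fun i => (A * R) i j) ⟨List.Pairwise.nil, by simp⟩ (by simp) hcol τ'
    rw [List.length_ofFn] at hgs
    refine hgs.bind fun Q τ₁ hQ => ?_
    obtain ⟨h1, h2, -, h4, h5⟩ := hQ
    have hq := h1.length_le h2
    rw [List.length_nil, zero_add] at h4
    refine (satisfies_matMul (listRows Q) A τ₁ |>.mono (Nat.mul_le_mul_right _ h4)
      fun _ _ h => h).bind fun B τ₂ hB => (satisfies_topSV hk B τ₂).mono ?_ fun Z _ hZ => ?_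
    -- The singular value routine costs only `O(r n m)` here, because `Q` has at most `r` and at
    -- most `m` vectors.
    · gcongr
      exact (min_le_left _ _).trans (hq.trans (min_le_left _ _))
    · refine ⟨Q.length, (listRows Q).transpose, listRows Q * (A * R), ?_, ?_, ?_⟩
      · rw [Matrix.transpose_transpose, h1.listRows_mul_transpose]
      · ext i j
        exact congrFun (h1.transpose_mulVec_mulVec
          (h5 _ ((List.mem_ofFn' _ _).2 ⟨j, rfl⟩))) i
      · rw [Matrix.transpose_transpose, ← hB]
        exact hZ
  refine (hZ.bind fun Z τ hZ => (satisfies_matMul A Z τ).mono le_rfl fun C _ hC => ?_).mono ?_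
    fun _ _ h => h
  · obtain ⟨q, Q, T, h1, h2, h3⟩ := hZ
    exact ⟨q, Q, T, Z, h1, h2, h3, hC⟩
  -- The stages contribute `1 + 3 + 11 + 3 + 3 = 21` and `2 κ` multiples of `r m n`; `24` leaves
  -- slack.
  · have hm : 1 ≤ m := hk1.trans hkm
    have hn : 1 ≤ n := hk1.trans hk
    have hr0 : 1 ≤ r := hk1.trans hkr
    have b1 : n * (r * 1) ≤ r * m * n := by
      calc n * (r * 1) ≤ n * (r * m) := by gcongr
        _ = r * m * n := by ring
    have b2 : m * (r * (2 * n + 1)) ≤ 3 * (r * m * n) := by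
      calc m * (r * (2 * n + 1)) ≤ m * (r * (2 * n + n)) := by gcongr
        _ = 3 * (r * m * n) := by ring
    have b3 : r * (min m n * (4 * m + 1) + (2 * m + 1) + m + 2) ≤ 11 * (r * m * n) := by
      have h1 : min m n * (4 * m + 1) ≤ 5 * (m * n) := by
        calc min m n * (4 * m + 1) ≤ n * (4 * m + m) := by gcongr; exact min_le_right _ _
          _ = 5 * (m * n) := by ring
      have h2 : m ≤ m * n := Nat.le_mul_of_pos_right m hn
      have h3 : min m n * (4 * m + 1) + (2 * m + 1) + m + 2 ≤ 11 * (m * n) := by omega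
      calc _ ≤ r * (11 * (m * n)) := Nat.mul_le_mul_left r h3
        _ = 11 * (r * m * n) := by ring
    have b4 : r * (n * (2 * m + 1)) ≤ 3 * (r * m * n) := by
      calc r * (n * (2 * m + 1)) ≤ r * (n * (2 * m + m)) := by gcongr
        _ = 3 * (r * m * n) := by ring
    have b5 : κ * (r * n * m + n * k ^ 2) ≤ 2 * κ * (r * m * n) := by
      calc κ * (r * n * m + n * k ^ 2) = κ * (r * n * m + n * (k * k)) := by ring
        _ ≤ κ * (r * n * m + n * (r * m)) := by gcongr
        _ = 2 * κ * (r * m * n) := by ring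
    have b6 : m * (k * (2 * n + 1)) ≤ 3 * (r * m * n) := by
      calc m * (k * (2 * n + 1)) ≤ m * (r * (2 * n + n)) := by gcongr
        _ = 3 * (r * m * n) := by ring
    rw [Nat.add_mul]
    omega

end RealProg

/-! ### Assembly of the running time and the success probability -/

theorem sketchSize_mul_le {k : ℕ} (hk : 1 ≤ k) {ε : ℝ} (hε : 0 < ε) (hε1 : ε < 1) :
    (RealProg.sketchSize k (ε / 100) : ℝ) ≤ 103 * (k / ε) := by
  have hk' : (1 : ℝ) ≤ k := by exact_mod_cast hk
  have h1 : (k : ℝ) ≤ k / ε := by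
    rw [le_div_iff₀ hε]; nlinarith
  -- The sketch size is at most `k + 100 k / ε + 1 + 1`; the terms `k`, `1` and `1` are each at most
  -- `k / ε`, hence `103`.
  have h2 := (Nat.ceil_lt_add_one (a := (k : ℝ) / (ε / 100) + 1) (by positivity)).le
  have h3 : (k : ℝ) / (ε / 100) = 100 * (k / ε) := by field_simp
  rw [RealProg.sketchSize]
  push_cast
  linarith

theorem le_sketchSize (k : ℕ) (ε : ℝ) :
    100 * k / ε + k + 1 ≤ (RealProg.sketchSize k (ε / 100) : ℝ) := by
  have h2 := Nat.le_ceil ((k : ℝ) / (ε / 100) + 1)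
  have h3 : (k : ℝ) / (ε / 100) = 100 * k / ε := by
    rw [div_div_eq_mul_div, mul_comm]
  rw [RealProg.sketchSize]
  push_cast
  linarith

/-- A probability is at most one. The sign of `δ` is needed to pass from `0.99 (1 - δ)` to `0.99 -
δ`. -/
theorem IsApproxKMeans.failure_nonneg {m d k : ℕ}
    {alg : Matrix (Fin m) (Fin d) ℝ → PMF (Matrix (Fin m) (Fin k) ℝ)} {γ δ : ℝ}
    (h : IsApproxKMeans alg γ δ) : 0 ≤ δ := by
  have h1 := (h.2 0).2
  have h2 : ∀ s, (alg 0).toOuterMeasure s ≤ 1 := fun s => by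
    rw [PMF.toOuterMeasure_apply, ← (alg 0).tsum_coe]
    exact ENNReal.tsum_le_tsum fun x => Set.indicator_le_self _ _ x
  have h3 := ENNReal.ofReal_le_one.1 (h1.trans (h2 _))
  linarith

/-- With probability at least `0.99` over the random tape, the Gaussian sketch is good, and then the
feature extraction has small error. -/
theorem exists_measurableSet_good_tape {m n k : ℕ} (hk : 1 ≤ k) (hkm : k ≤ m) (hkn : k ≤ n)
    {ε : ℝ} (hε : 0 < ε) (A : Matrix (Fin m) (Fin n) ℝ) (svd : SVDRoutine) (κ : ℕ) :
    ∃ E : Set (ℕ → ℝ), MeasurableSet E ∧ ENNReal.ofReal 0.99 ≤ gaussianTape E ∧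
      ∀ ω ∈ E, ∃ Z : Matrix (Fin n) (Fin k) ℝ, Z.transpose * Z = 1 ∧
        ((RealProg.featureExtraction A k hkn (ε / 100)).exec svd κ ω).value = A * Z ∧
        frobSq (A - A * Z * Z.transpose) ≤ (1 + ε) * optCost A k := by
  obtain ⟨V, hV, hopt⟩ := exists_orthogonal_frobSq_le_optCost hk hkm hkn A
  have hV' : V * V.transpose = 1 := mul_eq_one_comm.1 hV
  have hVT : V.transpose.transpose * V.transpose = 1 := by rwa [Matrix.transpose_transpose]
  have hV₁ := submatrix_orthonormal hkn hV
  have hV₁V := submatrix_transpose_mul hkn hV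
  set V₁ := V.submatrix id (Fin.castLE hkn) with hV₁def
  set N := A - A * V₁ * V₁.transpose with hN
  set r := RealProg.sketchSize k (ε / 100) with hr
  have hNV : ∀ i l, l.1 < k → (N * V) i l = 0 := by
    intro i l hl
    have h0 : N * V₁ = 0 := by
      rw [hN, Matrix.sub_mul, Matrix.mul_assoc (A * V₁), hV₁, Matrix.mul_one, sub_self]
    exact congrFun (congrFun h0 i) ⟨l, hl⟩
  obtain ⟨hmeas, hprob⟩ := gaussianMatrixLaw_good_sketch (m := m) (r := r) (by omega) hkn hε
    (le_sketchSize k ε) hNV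
  set S : Set (Fin n → Fin r → ℝ) := {R | (topRows hkn R * (topRows hkn R).transpose).det ≠ 0 ∧
    frobSq (N * V * Matrix.of R * topRowsInv hkn R) ≤ ε * frobSq (N * V)} with hS
  have hinj : Function.Injective (Function.uncurry fun (i : Fin n) (j : Fin r) =>
      j.1 + i.1 * r) := by
    rintro ⟨i, j⟩ ⟨i', j'⟩ h
    simp only [Function.uncurry] at h
    have hr0 : 0 < r := j.pos
    have h1 := congrArg (· % r) h
    have h2 := congrArg (· / r) h
    simp only [Nat.add_mul_mod_self_right, Nat.mod_eq_of_lt j.2, Nat.mod_eq_of_lt j'.2] at h1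
    simp only [Nat.add_mul_div_right _ _ hr0, Nat.div_eq_of_lt j.2, Nat.div_eq_of_lt j'.2,
      zero_add] at h2
    rw [Fin.ext h1, Fin.ext h2]
  -- `f` reads the sketch from the tape and `g` rotates it by `Vᵀ`; the composite still has the
  -- Gaussian law. In rotated coordinates `V₁ᵀ R` is the block of the first `k` rows, and `N V`
  -- vanishes on the first `k` columns.
  let f : (ℕ → ℝ) → Fin n → Fin r → ℝ := fun ω i j => ω (j.1 + i.1 * r)
  let g : (Fin n → Fin r → ℝ) → Fin n → Fin r → ℝ := fun R i j =>
    (V.transpose * Matrix.of R) i j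
  have hf : Measurable f := by fun_prop
  have hg : Measurable g := by
    simp only [g, Matrix.mul_apply]
    fun_prop
  refine ⟨f ⁻¹' (g ⁻¹' S), hf (hg hmeas), ?_, ?_⟩
  · rw [← Measure.map_apply hf (hg hmeas), map_gaussianTape hinj, ← Measure.map_apply hg hmeas,
      map_mul_gaussianMatrixLaw hVT]
    exact hprob
  intro ω hω
  obtain ⟨hdet, hle⟩ : g (f ω) ∈ S := hω
  obtain ⟨-, q, Q, T, Z, hQ, hT, hZ, hC⟩ :=
    RealProg.satisfies_featureExtraction (svd := svd) (κ := κ) A hk hkm hkn (ε / 100) ω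
  refine ⟨Z, hZ.transpose_mul_self, hC, ?_⟩
  have hVg : V * Matrix.of (g (f ω)) = Matrix.of (f ω) := by
    change V * (V.transpose * Matrix.of (f ω)) = _
    rw [← Matrix.mul_assoc, hV', Matrix.one_mul]
  have htop : V₁.transpose * Matrix.of (f ω) = topRows hkn (g (f ω)) := rfl
  have hH : V₁.transpose * Matrix.of (f ω) * topRowsInv hkn (g (f ω)) = 1 := by
    rw [htop, topRowsInv, ← Matrix.mul_assoc, Matrix.mul_nonsing_inv _ hdet.isUnit]
  have hmain := frobSq_sub_topRightSingularVectors_le (by omega) A hQ hT hZ hV₁ hH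
  have e1 : N * V * Matrix.of (g (f ω)) = N * Matrix.of (f ω) := by
    rw [Matrix.mul_assoc, hVg]
  have e2 : frobSq (N * V) = frobSq N := by
    have := frobSq_mul_transpose_of_orthonormal N hVT
    rwa [Matrix.transpose_transpose] at this
  rw [e1, e2] at hle
  calc frobSq (A - A * Z * Z.transpose) ≤ frobSq N + ε * frobSq N := hmain.trans (by gcongr)
    _ = (1 + ε) * frobSq N := by ring
    _ ≤ (1 + ε) * optCost A k := by gcongr

/-- The constant `K` in the running time depends only on the constant `κ` of the exact SVD routine.
The probability is over the random tape of the feature extraction and the independent randomness of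
the k-means algorithm, i.e. it is the expectation of the conditional probability given the tape. -/
theorem mainTheorem3 (κ : ℕ) :
    ∃ K : ℝ, 0 < K ∧
      ∀ (svd : SVDRoutine) (m n k : ℕ) (_ : 1 ≤ k) (_ : k ≤ m) (hkn : k ≤ n)
        (ε : ℝ) (_ : 0 < ε) (_ : ε < 1) (A : Matrix (Fin m) (Fin n) ℝ),
        (∀ ω : ℕ → ℝ,
          (((RealProg.featureExtraction A k hkn (ε / 100)).exec svd κ ω).steps : ℝ)
            ≤ K * ((m : ℝ) * n * k / ε)) ∧
        ∀ (γ δ : ℝ) (alg : Matrix (Fin m) (Fin k) ℝ → PMF (Matrix (Fin m) (Fin k) ℝ)),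
          IsApproxKMeans alg γ δ →
          ENNReal.ofReal (0.99 - δ) ≤
            ∫⁻ ω : ℕ → ℝ,
              (alg ((RealProg.featureExtraction A k hkn (ε / 100)).exec svd κ ω).value).toOuterMeasure
                {X | IsClusterIndicator X ∧
                  clusteringCost A X ≤ (1 + (1 + ε) * γ) * optCost A k}
              ∂gaussianTape := by

  -- `24 + 2 κ` bounds the steps per unit of `r m n`, and `103` bounds `r` per unit of `k / ε`.
  refine ⟨(24 + 2 * κ) * 103, by positivity, ?_⟩
  intro svd m n k hk hkm hkn ε hε hε1 A
  refine ⟨fun ω => ?_, fun γ δ alg halg => ?_⟩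
  · have h1 := (RealProg.satisfies_featureExtraction (svd := svd) (κ := κ) A hk hkm hkn
      (ε / 100) ω).1
    have h2 := sketchSize_mul_le hk hε hε1
    calc _ ≤ (((24 + 2 * κ) * (RealProg.sketchSize k (ε / 100) * m * n) : ℕ) : ℝ) := by
          exact_mod_cast h1
      _ = (24 + 2 * κ) * ((RealProg.sketchSize k (ε / 100) : ℝ) * m * n) := by push_cast; ring
      _ ≤ (24 + 2 * κ) * (103 * (k / ε) * m * n) := by gcongr
      _ = _ := by ring
  · obtain ⟨E, hE, hprob, hgood⟩ := exists_measurableSet_good_tape hk hkm hkn hε A svd κ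
    have hδ := halg.failure_nonneg
    calc ENNReal.ofReal (0.99 - δ) ≤ ENNReal.ofReal (1 - δ) * ENNReal.ofReal 0.99 := by
          rw [← ENNReal.ofReal_mul' (by norm_num)]
          exact ENNReal.ofReal_le_ofReal (by linarith)
      _ ≤ ENNReal.ofReal (1 - δ) * gaussianTape E := by gcongr
      -- Neither `svd` nor `alg` is assumed measurable, so the integrand is bounded below by a
      -- function that is: the indicator of the good event.
      _ = ∫⁻ ω, E.indicator (fun _ => ENNReal.ofReal (1 - δ)) ω ∂gaussianTape := by
          rw [lintegral_indicator_const hE]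
      _ ≤ _ := by
          refine lintegral_mono fun ω => ?_
          by_cases hω : ω ∈ E
          · obtain ⟨Z, hZ, hval, herr⟩ := hgood ω hω
            rw [Set.indicator_of_mem hω, hval]
            -- Inclusion is needed only on the support of the output law, where every matrix is a
            -- cluster indicator.
            refine ((halg.2 (A * Z)).2).trans (PMF.toOuterMeasure_mono _ ?_)
            rintro X ⟨hX, hsupp⟩
            have hind := (halg.2 (A * Z)).1 X hsupp
            exact ⟨hind, clusteringCost_le_of_features hk hkm hZ halg.1 hε.le herr hind hX⟩
          · rw [Set.indicator_of_notMem hω]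
            exact zero_le
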